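/- Let $\Phi$ be a unital qubit channel, i.e. a completely positive, trace-preserving linear map on the complex $2\times 2$ matrices with $\Phi(I)=I$. Let $\rho$ be a state (a positive semidefinite matrix of trace one) on $\mathbf{C}^K\otimes\mathbf{C}^2$, and let $r=\mathrm{Tr}_1\,\rho$ be its reduced $2\times 2$ density matrix, obtained by tracing out the first factor $\mathbf{C}^K$. Then there exist an integer $N\ge 1$, positive numbers $c_1,\dots,c_N$ with $\sum_{i=1}^N c_i=1$, and unitary $2\times 2$ matrices $U_1,\dots,U_N$ with $\mathrm{Tr}(\sigma_3 U_i r U_i^*)=0$ for $i=1,\dots,N$, such that for all real $p\ge 1$ $$\|(I\otimes\Phi)(\rho)\|_p\le m_p(0)^{-1}\,\nu_p(\Phi)\sum_{i=1}^N c_i\,\big\|(I\otimes\Psi_0)\big((I\otimes U_i)\,\rho\,(I\otimes U_i^*)\big)\big\|_p .$$ Here $\sigma_3=\begin{pmatrix}1&0\\0&-1\end{pmatrix}$; $\|A\|_p=(\mathrm{Tr}\,A^p)^{1/p}$ for a positive semidefinite matrix $A$; $\nu_p(\Phi)=\sup_{\omega}\|\Phi(\omega)\|_p$, the supremum being over all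 states $\omega$ on $\mathbf{C}^2$; $m_p(x)=\big[\big(\tfrac{1+x}{2}\big)^p+\big(\tfrac{1-x}{2}\big)^p\big]^{1/p}$; and $\Psi_0$ is the phase-damping channel that replaces the off-diagonal entries of a $2\times 2$ matrix by zero and leaves the diagonal entries unchanged. -/

import Mathlib

open scoped Matrix Kronecker MatrixOrder ComplexOrder

noncomputable section

/-- A state (density matrix): a positive semidefinite matrix of trace one. -/
def IsState {n : Type*} [Fintype n] (ρ : Matrix n n ℂ) : Prop :=
  ρ.PosSemidef ∧ ρ.trace = 1

/-- The half-noisy map `I ⊗ Φ` on matrices over `ℂ^m ⊗ ℂ^n`: `Φ` is applied to each of the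
`n × n` blocks of `M`. In particular it sends `A ⊗ₖ B` to `A ⊗ₖ Φ B`. -/
def idTensor {m n : Type*} (Φ : Matrix n n ℂ →ₗ[ℂ] Matrix n n ℂ) :
    Matrix (m × n) (m × n) ℂ →ₗ[ℂ] Matrix (m × n) (m × n) ℂ where
  toFun M := Matrix.of fun x y => Φ (Matrix.of fun a b => M (x.1, a) (y.1, b)) x.2 y.2
  map_add' M M' := by
    ext x y
    exact congrFun (congrFun (map_add Φ (Matrix.of fun a b => M (x.1, a) (y.1, b))
      (Matrix.of fun a b => M' (x.1, a) (y.1, b))) x.2) y.2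
  map_smul' c M := by
    ext x y
    exact congrFun (congrFun (map_smul Φ c (Matrix.of fun a b => M (x.1, a) (y.1, b))) x.2) y.2

/-- A channel: a completely positive, trace-preserving linear map. -/
structure IsChannel {n : Type*} [Fintype n] (Φ : Matrix n n ℂ →ₗ[ℂ] Matrix n n ℂ) : Prop where
  completelyPositive : ∀ (k : ℕ) (M : Matrix (Fin k × n) (Fin k × n) ℂ),
    M.PosSemidef → (idTensor Φ M).PosSemidef
  tracePreserving : ∀ M : Matrix n n ℂ, (Φ M).trace = M.trace

/-- A unital map: one which fixes the identity matrix. -/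
def IsUnital {n : Type*} [DecidableEq n] (Φ : Matrix n n ℂ →ₗ[ℂ] Matrix n n ℂ) : Prop :=
  Φ 1 = 1

/-- The `p`-norm `(Tr A ^ p) ^ (1 / p)` of a positive semidefinite matrix `A`, where `A ^ p` is
given by the continuous functional calculus. -/
def pNorm {n : Type*} [Fintype n] [DecidableEq n] (p : ℝ) (A : Matrix n n ℂ) : ℝ :=
  (A ^ p).trace.re ^ (1 / p)

/-- The maximal output `p`-norm `ν_p(Φ)`: the supremum of `‖Φ(ρ)‖_p` over all states `ρ`. -/
def maxPNorm {n : Type*} [Fintype n] [DecidableEq n] (p : ℝ)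
    (Φ : Matrix n n ℂ →ₗ[ℂ] Matrix n n ℂ) : ℝ :=
  sSup {x : ℝ | ∃ ρ : Matrix n n ℂ, IsState ρ ∧ x = pNorm p (Φ ρ)}

/-- `m_p(x) = [((1 + x) / 2) ^ p + ((1 - x) / 2) ^ p] ^ (1 / p)`. -/
def mFun (p x : ℝ) : ℝ :=
  (((1 + x) / 2) ^ p + ((1 - x) / 2) ^ p) ^ (1 / p)

/-- The phase-damping channel `Ψ_t`: it multiplies the off-diagonal entries by `t`. -/
def phaseDamping (t : ℝ) : Matrix (Fin 2) (Fin 2) ℂ →ₗ[ℂ] Matrix (Fin 2) (Fin 2) ℂ where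
  toFun r := !![r 0 0, t * r 0 1; t * r 1 0, r 1 1]
  map_add' r s := by
    ext i j
    fin_cases i <;> fin_cases j <;> simp [mul_add]
  map_smul' c r := by
    ext i j
    fin_cases i <;> fin_cases j <;> simp [mul_left_comm]

/-- The third Pauli matrix. -/
def pauliThree : Matrix (Fin 2) (Fin 2) ℂ := !![1, 0; 0, -1]

/-- The partial trace over the first tensor factor. -/
def traceFirst {m n : Type*} [Fintype m] (ρ : Matrix (m × n) (m × n) ℂ) : Matrix n n ℂ :=
  Matrix.of fun a b => ∑ k, ρ (k, a) (k, b)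

end

/-!
Two independent facts carry the proof.

*Phase damping.* Write `Z = 1 ⊗ σ₃`, so that `(I ⊗ Ψ_t)(ρ) = (1+t)/2 • ρ + (1-t)/2 • ZρZ`. For every
`ρ ≥ 0` and `|t| ≤ 1` one has `‖(I ⊗ Ψ_t)(ρ)‖_p ≤ m_p(0)⁻¹ m_p(t) ‖(I ⊗ Ψ_0)(ρ)‖_p`
(`pNorm_idTensor_phaseDamping_le`). With `S = ρ + ZρZ` one factors `ρ = S^{1/2} x S^{1/2}`, where
`0 ≤ x ≤ 1` and `ZxZ = 1 - x`. The Lieb–Thirring inequality `Tr (B^{1/2} A B^{1/2})^p ≤ Tr A^p B^p`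
separates `S` from `x`, and averaging over `Z` leaves the scalar inequality
`(s x + t (1-x))^p + (s (1-x) + t x)^p ≤ s^p + t^p` (`rpow_trace_reflection_mix_le`). Lieb–Thirring
itself (`lieb_thirring`) is the Hadamard three lines theorem for
`Tr B^{pz/2} A^{pz} B^{pz/2} H^{p(1-z)}`, `H = B^{1/2} A B^{1/2}`.

*Decomposition of `Φ`.* Let `t` be the norm of `Φ` on the Bloch ball; then `m_p(t) ≤ ν_p(Φ)`. For
any vector `r` of `ℝ³`, `Φ` is a mixture of channels `Ψ_t` rotated on both sides by unitaries, with
damping axes orthogonal to `r` (`IsChannel.exists_phaseDamping_mixture`). Taking for `r` the Bloch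
vector of the reduced state gives the condition `Tr (σ₃ U r U*) = 0`, and the theorem follows from
the first fact together with Minkowski's inequality (`pNorm_sum_le`) and unitary invariance of the
`p`-norm.

For the decomposition, unital channels are described by quadratic forms `D` on the quaternions `ℝ⁴`:
`Φ M = ∑ D j k • Q j * M * (Q k)ᴴ`. Complete positivity means `D ≥ 0`, the trace of `D` is one, and
`D(u) + D(v) ≤ (1+t)/2` for orthonormal `u`, `v`. A rotated `Ψ_t` is the form
`(1+t)/2 • u uᵀ + (1-t)/2 • v vᵀ` with `u ⊥ v`, and its axis is orthogonal to `r` exactly when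
`v ⊥ u r`. So `D` has to be in the convex hull of these forms. This is shown by duality
(`mem_convexHull_orthoPairs`): if a symmetric `X` has eigenvalues `x₀ ≤ x₁ ≤ x₂ ≤ x₃`, then
`Tr X D` is at most `(1+t)/2 x₃ + (1-t)/2 x₁`, and this value is reached or exceeded by taking the
top eigenvector for `u` and a vector `v ⊥ u r` in the span of the two middle ones.
-/

/-! ### Diagonalizations and the `p`-norm -/

section SpectralDecomposition

variable {n : Type*} [Fintype n] [DecidableEq n]

/-- The matrix `V diag(d) Vᴴ`. -/
def conjDiag (V : Matrix n n ℂ) (d : n → ℂ) : Matrix n n ℂ :=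
  V * Matrix.diagonal d * Vᴴ

theorem unitary_conjTranspose_mul {V : Matrix n n ℂ} (hV : V ∈ Matrix.unitaryGroup n ℂ) :
    Vᴴ * V = 1 :=
  Matrix.mem_unitaryGroup_iff'.mp hV

theorem unitary_mul_conjTranspose {V : Matrix n n ℂ} (hV : V ∈ Matrix.unitaryGroup n ℂ) :
    V * Vᴴ = 1 :=
  Matrix.mem_unitaryGroup_iff.mp hV

theorem unitary_conjTranspose_mem {V : Matrix n n ℂ} (hV : V ∈ Matrix.unitaryGroup n ℂ) :
    Vᴴ ∈ Matrix.unitaryGroup n ℂ := by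
  rw [Matrix.mem_unitaryGroup_iff, Matrix.star_eq_conjTranspose, Matrix.conjTranspose_conjTranspose]
  exact unitary_conjTranspose_mul hV

theorem conjDiag_mul {V : Matrix n n ℂ} (hV : V ∈ Matrix.unitaryGroup n ℂ) (d e : n → ℂ) :
    conjDiag V d * conjDiag V e = conjDiag V (d * e) := by
  have h : Matrix.diagonal (d * e) = Matrix.diagonal d * (Vᴴ * V) * Matrix.diagonal e := by
    rw [unitary_conjTranspose_mul hV, mul_one, Matrix.diagonal_mul_diagonal]; rfl
  simp only [conjDiag, h, mul_assoc]

theorem conjDiag_conjTranspose (V : Matrix n n ℂ) (d : n → ℂ) :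
    (conjDiag V d)ᴴ = conjDiag V (star d) := by
  simp [conjDiag, Matrix.conjTranspose_mul, Matrix.diagonal_conjTranspose, mul_assoc]

theorem conjDiag_trace {V : Matrix n n ℂ} (hV : V ∈ Matrix.unitaryGroup n ℂ) (d : n → ℂ) :
    (conjDiag V d).trace = ∑ i, d i := by
  rw [conjDiag, Matrix.trace_mul_cycle, unitary_conjTranspose_mul hV, one_mul,
    Matrix.trace_diagonal]

theorem conjDiag_add (V : Matrix n n ℂ) (d e : n → ℂ) :
    conjDiag V (d + e) = conjDiag V d + conjDiag V e := by
  have h : Matrix.diagonal (d + e) = Matrix.diagonal d + Matrix.diagonal e :=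
    (Matrix.diagonal_add d e).symm
  simp only [conjDiag, h, mul_add, add_mul]

theorem conjDiag_smul (V : Matrix n n ℂ) (c : ℂ) (d : n → ℂ) :
    conjDiag V (c • d) = c • conjDiag V d := by
  rw [conjDiag, Matrix.diagonal_smul, mul_smul_comm, smul_mul_assoc]; rfl

theorem conjDiag_one {V : Matrix n n ℂ} (hV : V ∈ Matrix.unitaryGroup n ℂ) :
    conjDiag V 1 = 1 := by
  rw [conjDiag, Matrix.diagonal_one', mul_one, unitary_mul_conjTranspose hV]

theorem conj_conjDiag (W V : Matrix n n ℂ) (d : n → ℂ) :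
    W * conjDiag V d * Wᴴ = conjDiag (W * V) d := by
  simp only [conjDiag, Matrix.conjTranspose_mul, mul_assoc]

/-- The functional calculus does not depend on the chosen diagonalization. -/
theorem conjDiag_map_congr {V W : Matrix n n ℂ} (hV : V ∈ Matrix.unitaryGroup n ℂ)
    (hW : W ∈ Matrix.unitaryGroup n ℂ) {a b : n → ℝ} (f : ℝ → ℂ)
    (h : conjDiag V (fun i => (a i : ℂ)) = conjDiag W (fun i => (b i : ℂ))) :
    conjDiag V (fun i => f (a i)) = conjDiag W (fun i => f (b i)) := by
  have key : ∀ d e : n → ℂ, conjDiag V d = conjDiag W e ↔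
      Matrix.diagonal d * (Vᴴ * W) = (Vᴴ * W) * Matrix.diagonal e := by
    intro d e
    constructor
    · intro h
      calc Matrix.diagonal d * (Vᴴ * W) = (Vᴴ * V) * Matrix.diagonal d * Vᴴ * W := by
            rw [unitary_conjTranspose_mul hV]; simp [mul_assoc]
        _ = Vᴴ * conjDiag V d * W := by simp only [conjDiag, mul_assoc]
        _ = (Vᴴ * W) * Matrix.diagonal e * (Wᴴ * W) := by rw [h]; simp only [conjDiag, mul_assoc]
        _ = _ := by rw [unitary_conjTranspose_mul hW, mul_one]
    · intro h
      calc conjDiag V d = V * (Matrix.diagonal d * (Vᴴ * W)) * Wᴴ := by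
            simp only [conjDiag, mul_assoc]
            rw [unitary_mul_conjTranspose hW, mul_one]
        _ = (V * Vᴴ) * W * Matrix.diagonal e * Wᴴ := by rw [h]; simp only [mul_assoc]
        _ = conjDiag W e := by rw [unitary_mul_conjTranspose hV, one_mul]; rfl
  rw [key] at h ⊢
  ext i j
  have hij := congrFun (congrFun h i) j
  rw [Matrix.diagonal_mul, Matrix.mul_diagonal] at hij ⊢
  by_cases h0 : (Vᴴ * W) i j = 0
  · simp [h0]
  · have : (a i : ℂ) = b j := by
      apply mul_right_cancel₀ h0
      rw [hij, mul_comm]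
    rw [Complex.ofReal_inj.mp this, mul_comm]

theorem isHermitian_exists_conjDiag {A : Matrix n n ℂ} (hA : A.IsHermitian) :
    ∃ V ∈ Matrix.unitaryGroup n ℂ, ∃ a : n → ℝ, A = conjDiag V (fun i => (a i : ℂ)) :=
  ⟨hA.eigenvectorUnitary, hA.eigenvectorUnitary.2, hA.eigenvalues, by
    conv_lhs => rw [hA.spectral_theorem, Unitary.conjStarAlgAut_apply]
    rfl⟩

theorem posSemidef_exists_conjDiag {A : Matrix n n ℂ} (hA : A.PosSemidef) :
    ∃ V ∈ Matrix.unitaryGroup n ℂ, ∃ a : n → ℝ, (∀ i, 0 ≤ a i) ∧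
      A = conjDiag V (fun i => (a i : ℂ)) :=
  ⟨hA.1.eigenvectorUnitary, hA.1.eigenvectorUnitary.2, hA.1.eigenvalues, hA.eigenvalues_nonneg, by
    conv_lhs => rw [hA.1.spectral_theorem, Unitary.conjStarAlgAut_apply]
    rfl⟩

theorem conjDiag_posSemidef (V : Matrix n n ℂ) {a : n → ℝ} (ha : ∀ i, 0 ≤ a i) :
    (conjDiag V (fun i => (a i : ℂ))).PosSemidef :=
  (Matrix.PosSemidef.diagonal (fun i => by simpa using ha i)).mul_mul_conjTranspose_same V

theorem rpow_conjDiag {V : Matrix n n ℂ} (hV : V ∈ Matrix.unitaryGroup n ℂ) {a : n → ℝ}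
    (ha : ∀ i, 0 ≤ a i) (p : ℝ) :
    (conjDiag V (fun i => (a i : ℂ))) ^ p = conjDiag V (fun i => ((a i ^ p : ℝ) : ℂ)) := by
  set A := conjDiag V (fun i => (a i : ℂ)) with hAdef
  have hA : A.PosSemidef := conjDiag_posSemidef V ha
  have h1 : A = conjDiag hA.1.eigenvectorUnitary (fun i => (hA.1.eigenvalues i : ℂ)) := by
    conv_lhs => rw [hA.1.spectral_theorem, Unitary.conjStarAlgAut_apply]
    rfl
  rw [CFC.rpow_eq_cfc_real (ha := Matrix.nonneg_iff_posSemidef.mpr hA), hA.1.cfc_eq,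
    Matrix.IsHermitian.cfc, Unitary.conjStarAlgAut_apply]
  exact (conjDiag_map_congr hV hA.1.eigenvectorUnitary.2 (fun x => ((x ^ p : ℝ) : ℂ))
    (hAdef.symm.trans h1)).symm

theorem pNorm_conjDiag {V : Matrix n n ℂ} (hV : V ∈ Matrix.unitaryGroup n ℂ) {a : n → ℝ}
    (ha : ∀ i, 0 ≤ a i) (p : ℝ) :
    pNorm p (conjDiag V (fun i => (a i : ℂ))) = (∑ i, a i ^ p) ^ (1 / p) := by
  rw [pNorm, rpow_conjDiag hV ha, conjDiag_trace hV, ← Complex.ofReal_sum, Complex.ofReal_re]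

theorem pNorm_unitary_conj {A W : Matrix n n ℂ} (hA : A.PosSemidef)
    (hW : W ∈ Matrix.unitaryGroup n ℂ) (p : ℝ) :
    pNorm p (W * A * Wᴴ) = pNorm p A := by
  obtain ⟨V, hV, a, ha, rfl⟩ := posSemidef_exists_conjDiag hA
  rw [conj_conjDiag, pNorm_conjDiag hV ha, pNorm_conjDiag (mul_mem hW hV) ha]

theorem rpow_trace_nonneg {A : Matrix n n ℂ} (hA : A.PosSemidef) (p : ℝ) :
    0 ≤ (A ^ p).trace.re := by
  obtain ⟨V, hV, a, ha, rfl⟩ := posSemidef_exists_conjDiag hA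
  rw [rpow_conjDiag hV ha, conjDiag_trace hV, ← Complex.ofReal_sum, Complex.ofReal_re]
  exact Finset.sum_nonneg fun i _ => Real.rpow_nonneg (ha i) _

theorem pNorm_nonneg {A : Matrix n n ℂ} (hA : A.PosSemidef) (p : ℝ) :
    0 ≤ pNorm p A :=
  Real.rpow_nonneg (rpow_trace_nonneg hA p) _

theorem pNorm_smul {A : Matrix n n ℂ} (hA : A.PosSemidef) {c : ℝ} (hc : 0 ≤ c) {p : ℝ}
    (hp : 1 ≤ p) : pNorm p ((c : ℂ) • A) = c * pNorm p A := by
  obtain ⟨V, hV, a, ha, rfl⟩ := posSemidef_exists_conjDiag hA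
  have h : (c : ℂ) • conjDiag V (fun i => (a i : ℂ)) =
      conjDiag V (fun i => ((c * a i : ℝ) : ℂ)) := by
    rw [← conjDiag_smul]; congr 1; ext i; simp
  rw [h, pNorm_conjDiag hV (fun i => mul_nonneg hc (ha i)), pNorm_conjDiag hV ha]
  simp_rw [fun i => Real.mul_rpow hc (ha i) (z := p)]
  rw [← Finset.mul_sum, Real.mul_rpow (Real.rpow_nonneg hc _)
    (Finset.sum_nonneg fun i _ => Real.rpow_nonneg (ha i) _), ← Real.rpow_mul hc,
    mul_one_div_cancel (by linarith), Real.rpow_one]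

theorem conjDiag_apply_self (V : Matrix n n ℂ) (a : n → ℝ) (i : n) :
    conjDiag V (fun j => (a j : ℂ)) i i = ((∑ j, Complex.normSq (V i j) * a j : ℝ) : ℂ) := by
  rw [conjDiag, Matrix.mul_apply, Complex.ofReal_sum]
  refine Finset.sum_congr rfl fun j _ => ?_
  rw [Matrix.mul_diagonal, Matrix.conjTranspose_apply, Complex.ofReal_mul, ← Complex.mul_conj]
  simp only [RCLike.star_def]; ring

theorem unitary_row_sum_normSq {V : Matrix n n ℂ} (hV : V ∈ Matrix.unitaryGroup n ℂ) (i : n) :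
    ∑ j, Complex.normSq (V i j) = 1 := by
  have h := congrFun (congrFun (unitary_mul_conjTranspose hV) i) i
  rw [Matrix.mul_apply, Matrix.one_apply_eq] at h
  simp only [Matrix.conjTranspose_apply, RCLike.star_def, Complex.mul_conj] at h
  exact_mod_cast h

/-- Peierls' inequality: the diagonal of a positive semidefinite matrix has smaller `ℓ^p` norm
than its spectrum. -/
theorem sum_diag_rpow_le {A : Matrix n n ℂ} (hA : A.PosSemidef) {p : ℝ} (hp : 1 ≤ p) :
    ∑ i, (A i i).re ^ p ≤ (A ^ p).trace.re := by
  obtain ⟨V, hV, a, ha, rfl⟩ := posSemidef_exists_conjDiag hA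
  rw [rpow_conjDiag hV ha, Matrix.trace, Complex.re_sum]
  refine Finset.sum_le_sum fun i _ => ?_
  rw [Matrix.diag_apply, conjDiag_apply_self, conjDiag_apply_self, Complex.ofReal_re,
    Complex.ofReal_re]
  exact Real.rpow_arith_mean_le_arith_mean_rpow _ _ _ (fun j _ => Complex.normSq_nonneg _)
    (unitary_row_sum_normSq hV i) (fun j _ => ha j) hp

/-- Minkowski's inequality for the `p`-norm of positive semidefinite matrices. -/
theorem pNorm_add_le {A B : Matrix n n ℂ} (hA : A.PosSemidef) (hB : B.PosSemidef) {p : ℝ}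
    (hp : 1 ≤ p) : pNorm p (A + B) ≤ pNorm p A + pNorm p B := by
  obtain ⟨V, hV, a, ha, h⟩ := posSemidef_exists_conjDiag (hA.add hB)
  have hV' := unitary_conjTranspose_mem hV
  -- In an eigenbasis of `A + B` the diagonals of `A` and `B` add up to the spectrum of `A + B`.
  set A' := Vᴴ * A * Vᴴᴴ with hA'
  set B' := Vᴴ * B * Vᴴᴴ with hB'
  have hpA : A'.PosSemidef := hA.mul_mul_conjTranspose_same _
  have hpB : B'.PosSemidef := hB.mul_mul_conjTranspose_same _
  have hab : ∀ i, a i = (A' i i).re + (B' i i).re := by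
    intro i
    have h1 : A' + B' = Matrix.diagonal (fun i => (a i : ℂ)) := by
      rw [hA', hB', ← add_mul, ← mul_add, h, conj_conjDiag, unitary_conjTranspose_mul hV]
      simp [conjDiag]
    have h2 := congrFun (congrFun h1 i) i
    rw [Matrix.diagonal_apply_eq, Matrix.add_apply] at h2
    rw [← Complex.add_re, h2, Complex.ofReal_re]
  have hle : ∀ {C : Matrix n n ℂ}, C.PosSemidef →
      (∑ i, (C i i).re ^ p) ^ (1 / p) ≤ pNorm p C := fun hC =>
    Real.rpow_le_rpow (Finset.sum_nonneg fun i _ => Real.rpow_nonneg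
      (Complex.nonneg_iff.mp (hC.diag_nonneg (i := i))).1 _) (sum_diag_rpow_le hC hp)
      (by positivity)
  rw [h, pNorm_conjDiag hV ha, ← pNorm_unitary_conj hA hV', ← pNorm_unitary_conj hB hV']
  simp_rw [hab]
  refine (Real.Lp_add_le_of_nonneg _ hp
    (fun i _ => (Complex.nonneg_iff.mp (hpA.diag_nonneg (i := i))).1)
    (fun i _ => (Complex.nonneg_iff.mp (hpB.diag_nonneg (i := i))).1)).trans ?_
  exact add_le_add (hle hpA) (hle hpB)

theorem pNorm_zero {p : ℝ} (hp : 1 ≤ p) : pNorm p (0 : Matrix n n ℂ) = 0 := by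
  have h := pNorm_smul (Matrix.PosSemidef.zero (n := n) (R := ℂ)) (le_refl (0 : ℝ)) hp
  simpa using h

theorem pNorm_sum_le {ι : Type*} (s : Finset ι) (c : ι → ℝ) (A : ι → Matrix n n ℂ)
    (hc : ∀ i, 0 ≤ c i) (hA : ∀ i, (A i).PosSemidef) {p : ℝ} (hp : 1 ≤ p) :
    pNorm p (∑ i ∈ s, (c i : ℂ) • A i) ≤ ∑ i ∈ s, c i * pNorm p (A i) := by
  classical
  have hcA : ∀ i, ((c i : ℂ) • A i).PosSemidef := fun i =>
    (hA i).smul (by simpa using hc i)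
  induction s using Finset.induction_on with
  | empty => simp [pNorm_zero hp]
  | insert i s hi ih =>
    rw [Finset.sum_insert hi, Finset.sum_insert hi]
    refine (pNorm_add_le (hcA i) (Matrix.posSemidef_sum s fun j _ => hcA j) hp).trans ?_
    rw [pNorm_smul (hA i) (hc i) hp]
    exact add_le_add le_rfl ih

end SpectralDecomposition

/-! ### Complex powers on the strip `0 ≤ Re z ≤ 1` -/

section StripFunctions

open Complex.HadamardThreeLines

/-- Entire functions which are bounded on the closed strip `0 ≤ Re z ≤ 1`. -/
def EntireStripBounded (f : ℂ → ℂ) : Prop :=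
  Differentiable ℂ f ∧ ∃ C : ℝ, ∀ z ∈ verticalClosedStrip 0 1, ‖f z‖ ≤ C

theorem EntireStripBounded.const (c : ℂ) : EntireStripBounded fun _ => c :=
  ⟨differentiable_const c, ‖c‖, fun _ _ => le_rfl⟩

theorem EntireStripBounded.add {f g : ℂ → ℂ} (hf : EntireStripBounded f)
    (hg : EntireStripBounded g) : EntireStripBounded fun z => f z + g z := by
  obtain ⟨hf, C, hC⟩ := hf
  obtain ⟨hg, D, hD⟩ := hg
  exact ⟨hf.add hg, C + D, fun z hz => (norm_add_le _ _).trans (add_le_add (hC z hz) (hD z hz))⟩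

theorem EntireStripBounded.mul {f g : ℂ → ℂ} (hf : EntireStripBounded f)
    (hg : EntireStripBounded g) : EntireStripBounded fun z => f z * g z := by
  obtain ⟨hf, C, hC⟩ := hf
  obtain ⟨hg, D, hD⟩ := hg
  refine ⟨hf.mul hg, C * D, fun z hz => ?_⟩
  rw [norm_mul]
  exact mul_le_mul (hC z hz) (hD z hz) (norm_nonneg _) ((norm_nonneg _).trans (hC z hz))

theorem EntireStripBounded.sum {ι : Type*} (s : Finset ι) {f : ι → ℂ → ℂ}
    (hf : ∀ i, EntireStripBounded (f i)) : EntireStripBounded fun z => ∑ i ∈ s, f i z := by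
  classical
  induction s using Finset.induction_on with
  | empty => simpa using EntireStripBounded.const 0
  | insert i s hi ih => simpa only [Finset.sum_insert hi] using (hf i).add ih

/-- The complex power `x ^ z` of a real number `x ≥ 0`, with the convention `0 ^ z = 0` for every
`z`. In contrast to Mathlib's `0 ^ 0 = 1`, this makes it entire in `z` for each `x`; imaginary
powers of a positive semidefinite matrix become partial isometries. -/
noncomputable def suppCpow (x : ℝ) (z : ℂ) : ℂ :=
  if x = 0 then 0 else Complex.exp (z * Real.log x)

theorem suppCpow_ofReal {x : ℝ} (hx : 0 ≤ x) {y : ℝ} (hy : 0 < y) :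
    suppCpow x y = ((x ^ y : ℝ) : ℂ) := by
  unfold suppCpow
  split_ifs with h
  · simp [h, Real.zero_rpow hy.ne']
  · rw [Real.rpow_def_of_pos (lt_of_le_of_ne hx (Ne.symm h))]
    push_cast; ring_nf

theorem norm_suppCpow {x : ℝ} (hx : 0 ≤ x) {z : ℂ} (hz : 0 < z.re) :
    ‖suppCpow x z‖ = x ^ z.re := by
  unfold suppCpow
  split_ifs with h
  · simp [h, Real.zero_rpow hz.ne']
  · rw [Complex.norm_exp, Real.rpow_def_of_pos (lt_of_le_of_ne hx (Ne.symm h))]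
    simp [mul_comm]

theorem norm_suppCpow_le_one (x : ℝ) {z : ℂ} (hz : z.re = 0) : ‖suppCpow x z‖ ≤ 1 := by
  unfold suppCpow
  split_ifs with h
  · simp
  · simp [Complex.norm_exp, hz]

theorem suppCpow_add (x : ℝ) (z w : ℂ) : suppCpow x (z + w) = suppCpow x z * suppCpow x w := by
  unfold suppCpow
  split_ifs with h
  · simp
  · rw [← Complex.exp_add, add_mul]

theorem entireStripBounded_suppCpow (x a b : ℝ) :
    EntireStripBounded fun z => suppCpow x (a * z + b) := by
  unfold suppCpow
  split_ifs with h
  · exact EntireStripBounded.const 0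
  · refine ⟨by fun_prop, Real.exp ((|a| + |b|) * |Real.log x|), fun z hz => ?_⟩
    rw [verticalClosedStrip, Set.mem_preimage, Set.mem_Icc] at hz
    rw [Complex.norm_exp]
    apply Real.exp_le_exp.mpr
    have h1 : ((a * z + b) * Real.log x : ℂ).re = (a * z.re + b) * Real.log x := by simp
    rw [h1]
    refine (le_abs_self _).trans ?_
    rw [abs_mul]
    refine mul_le_mul_of_nonneg_right ((abs_add_le _ _).trans ?_) (abs_nonneg _)
    rw [abs_mul, abs_of_nonneg hz.1]
    have := mul_le_mul_of_nonneg_left hz.2 (abs_nonneg a)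
    linarith

variable {n : Type*} [Fintype n]

theorem entireStripBounded_matrix_mul {M N : ℂ → Matrix n n ℂ}
    (hM : ∀ i j, EntireStripBounded fun z => M z i j)
    (hN : ∀ i j, EntireStripBounded fun z => N z i j) (i j : n) :
    EntireStripBounded fun z => (M z * N z) i j := by
  simp only [Matrix.mul_apply]
  exact EntireStripBounded.sum _ fun k => (hM i k).mul (hN k j)

theorem entireStripBounded_conjDiag [DecidableEq n] (V : Matrix n n ℂ) {d : ℂ → n → ℂ}
    (hd : ∀ i, EntireStripBounded fun z => d z i) (i j : n) :
    EntireStripBounded fun z => conjDiag V (d z) i j := by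
  refine entireStripBounded_matrix_mul (M := fun z => V * Matrix.diagonal (d z))
    (N := fun _ => Vᴴ) (entireStripBounded_matrix_mul (M := fun _ => V)
      (fun _ _ => EntireStripBounded.const _) fun k l => ?_)
    (fun _ _ => EntireStripBounded.const _) i j
  by_cases h : k = l
  · subst h; simpa using hd k
  · simpa [Matrix.diagonal_apply_ne _ h] using EntireStripBounded.const 0

end StripFunctions

/-! ### The Lieb–Thirring inequality -/

section LiebThirring

variable {n : Type*} [Fintype n]

theorem sum_normSq_eq_trace (M : Matrix n n ℂ) :
    ∑ i, ∑ j, ‖M i j‖ ^ 2 = (M * Mᴴ).trace.re := by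
  simp only [Matrix.trace, Matrix.diag_apply, Matrix.mul_apply, Matrix.conjTranspose_apply,
    Complex.re_sum]
  refine Finset.sum_congr rfl fun i _ => Finset.sum_congr rfl fun j _ => ?_
  rw [RCLike.star_def, Complex.mul_conj, Complex.ofReal_re, Complex.normSq_eq_norm_sq]

variable [DecidableEq n]

section

open scoped Matrix.Norms.L2Operator

theorem norm_apply_le_l2_opNorm (A : Matrix n n ℂ) (i j : n) : ‖A i j‖ ≤ ‖A‖ := by
  have h := Matrix.l2_opNorm_mulVec A (EuclideanSpace.single j (1 : ℂ))
  rw [PiLp.norm_single, norm_one, mul_one] at h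
  refine le_trans ?_ h
  refine le_trans (le_of_eq ?_) (PiLp.norm_apply_le _ i)
  simp

theorem l2_opNorm_unitary_le {V : Matrix n n ℂ} (hV : V ∈ Matrix.unitaryGroup n ℂ) :
    ‖V‖ ≤ 1 := by
  have h := Matrix.l2_opNorm_conjTranspose_mul_self V
  rw [unitary_conjTranspose_mul hV] at h
  have h1 : ‖(1 : Matrix n n ℂ)‖ ≤ 1 := by
    rw [← Matrix.diagonal_one', Matrix.l2_opNorm_diagonal]
    exact (pi_norm_le_iff_of_nonneg zero_le_one).mpr fun _ => by simp
  nlinarith [norm_nonneg V]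

theorem l2_opNorm_conjDiag_le {V : Matrix n n ℂ} (hV : V ∈ Matrix.unitaryGroup n ℂ) {d : n → ℂ}
    (hd : ∀ i, ‖d i‖ ≤ 1) : ‖conjDiag V d‖ ≤ 1 := by
  have h1 : ‖(Matrix.diagonal d : Matrix n n ℂ)‖ ≤ 1 := by
    rw [Matrix.l2_opNorm_diagonal]
    exact (pi_norm_le_iff_of_nonneg zero_le_one).mpr hd
  calc ‖conjDiag V d‖ ≤ ‖V‖ * ‖(Matrix.diagonal d : Matrix n n ℂ)‖ * ‖Vᴴ‖ :=
        (Matrix.l2_opNorm_mul _ _).trans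
          (mul_le_mul_of_nonneg_right (Matrix.l2_opNorm_mul _ _) (norm_nonneg _))
    _ ≤ 1 * 1 * 1 := by
        gcongr
        · exact l2_opNorm_unitary_le hV
        · exact l2_opNorm_unitary_le (unitary_conjTranspose_mem hV)
    _ = 1 := by norm_num

/-- Pairing a product of contractions with a diagonalized matrix. -/
theorem norm_trace_contraction_mul_le {V W Y : Matrix n n ℂ} (hV : V ∈ Matrix.unitaryGroup n ℂ)
    (hW : W ∈ Matrix.unitaryGroup n ℂ) (hY : Y ∈ Matrix.unitaryGroup n ℂ) {a b h : n → ℂ}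
    (ha : ∀ i, ‖a i‖ ≤ 1) (hb : ∀ i, ‖b i‖ ≤ 1) :
    ‖(conjDiag W b * conjDiag V a * conjDiag W b * conjDiag Y h).trace‖ ≤ ∑ i, ‖h i‖ := by
  set K := conjDiag W b * conjDiag V a * conjDiag W b with hK
  have hKn : ‖K‖ ≤ 1 := by
    calc ‖K‖ ≤ ‖conjDiag W b‖ * ‖conjDiag V a‖ * ‖conjDiag W b‖ :=
          (Matrix.l2_opNorm_mul _ _).trans
            (mul_le_mul_of_nonneg_right (Matrix.l2_opNorm_mul _ _) (norm_nonneg _))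
      _ ≤ 1 * 1 * 1 := by
          gcongr
          · exact l2_opNorm_conjDiag_le hW hb
          · exact l2_opNorm_conjDiag_le hV ha
          · exact l2_opNorm_conjDiag_le hW hb
      _ = 1 := by norm_num
  have hYK : ‖Yᴴ * K * Y‖ ≤ 1 := by
    calc ‖Yᴴ * K * Y‖ ≤ ‖Yᴴ‖ * ‖K‖ * ‖Y‖ :=
          (Matrix.l2_opNorm_mul _ _).trans
            (mul_le_mul_of_nonneg_right (Matrix.l2_opNorm_mul _ _) (norm_nonneg _))
      _ ≤ 1 * 1 * 1 := by
          gcongr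
          · exact l2_opNorm_unitary_le (unitary_conjTranspose_mem hY)
          · exact l2_opNorm_unitary_le hY
      _ = 1 := by norm_num
  have h1 : (K * conjDiag Y h).trace = (Yᴴ * K * Y * Matrix.diagonal h).trace := by
    rw [conjDiag, ← mul_assoc, Matrix.trace_mul_comm]
    simp only [mul_assoc]
  rw [h1, Matrix.trace]
  refine (norm_sum_le _ _).trans (Finset.sum_le_sum fun i _ => ?_)
  rw [Matrix.diag_apply, Matrix.mul_diagonal, norm_mul]
  exact mul_le_of_le_one_left (norm_nonneg _) ((norm_apply_le_l2_opNorm _ i i).trans hYK)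

end

/-- The Cauchy–Schwarz inequality for the Hilbert–Schmidt norm, in the symmetric case. -/
theorem norm_trace_mul_diagonal_le (M N : Matrix n n ℂ) {d : n → ℂ} (hd : ∀ i, ‖d i‖ ≤ 1) {L : ℝ}
    (hM : (M * Mᴴ).trace.re = L) (hN : (N * Nᴴ).trace.re = L) :
    ‖(M * N * Matrix.diagonal d).trace‖ ≤ L := by
  have h1 : ‖(M * N * Matrix.diagonal d).trace‖ ≤
      ∑ i, ∑ j, (‖M i j‖ ^ 2 + ‖N j i‖ ^ 2) / 2 := by
    rw [Matrix.trace]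
    refine (norm_sum_le _ _).trans (Finset.sum_le_sum fun i _ => ?_)
    rw [Matrix.diag_apply, Matrix.mul_diagonal, norm_mul]
    refine (mul_le_of_le_one_right (norm_nonneg _) (hd i)).trans ?_
    rw [Matrix.mul_apply]
    refine (norm_sum_le _ _).trans (Finset.sum_le_sum fun j _ => ?_)
    rw [norm_mul]
    nlinarith [sq_nonneg (‖M i j‖ - ‖N j i‖)]
  have h2 : ∑ i, ∑ j, (‖M i j‖ ^ 2 + ‖N j i‖ ^ 2) / 2 = L := by
    simp only [← Finset.sum_div, Finset.sum_add_distrib]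
    rw [Finset.sum_comm (f := fun i j => ‖N j i‖ ^ 2), sum_normSq_eq_trace, sum_normSq_eq_trace,
      hM, hN]
    ring
  exact h1.trans h2.le

/-- The **Lieb–Thirring inequality** `Tr (B^{1/2} A B^{1/2})^p ≤ Tr A^p B^p` for positive
semidefinite matrices given by diagonalizations. It is the three lines theorem for
`Tr B^{pz/2} A^{pz} B^{pz/2} H^{p(1-z)}` at `z = 1/p`, where `H = B^{1/2} A B^{1/2}`. -/
theorem lieb_thirring {V W Y : Matrix n n ℂ} (hV : V ∈ Matrix.unitaryGroup n ℂ)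
    (hW : W ∈ Matrix.unitaryGroup n ℂ) (hY : Y ∈ Matrix.unitaryGroup n ℂ) {a b h : n → ℝ}
    (ha : ∀ i, 0 ≤ a i) (hb : ∀ i, 0 ≤ b i) (hh : ∀ i, 0 ≤ h i)
    (hH : conjDiag W (fun i => ((b i ^ (1 / 2 : ℝ) : ℝ) : ℂ)) * conjDiag V (fun i => (a i : ℂ)) *
      conjDiag W (fun i => ((b i ^ (1 / 2 : ℝ) : ℝ) : ℂ)) = conjDiag Y (fun i => (h i : ℂ)))
    {p : ℝ} (hp : 1 ≤ p) :
    ∑ i, h i ^ p ≤ (conjDiag V (fun i => ((a i ^ p : ℝ) : ℂ)) *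
      conjDiag W (fun i => ((b i ^ p : ℝ) : ℂ))).trace.re := by
  have hp0 : 0 < p := by linarith
  set L := (conjDiag V (fun i => ((a i ^ p : ℝ) : ℂ)) *
      conjDiag W (fun i => ((b i ^ p : ℝ) : ℂ))).trace.re with hL
  set T := ∑ i, h i ^ p with hT
  have hT0 : 0 ≤ T := Finset.sum_nonneg fun i _ => Real.rpow_nonneg (hh i) _
  let B : ℂ → Matrix n n ℂ := fun z =>
    conjDiag W (fun i => suppCpow (b i) ((p / 2 : ℝ) * z + (0 : ℝ)))
  let A : ℂ → Matrix n n ℂ := fun z => conjDiag V (fun i => suppCpow (a i) (p * z + (0 : ℝ)))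
  let A' : ℂ → Matrix n n ℂ := fun z =>
    conjDiag V (fun i => suppCpow (a i) ((p / 2 : ℝ) * z + (0 : ℝ)))
  let D : ℂ → n → ℂ := fun z i => suppCpow (h i) ((-p : ℝ) * z + p)
  let f : ℂ → ℂ := fun z => (B z * A z * B z * conjDiag Y (D z)).trace
  have hAA : ∀ z, A z = A' z * A' z := by
    intro z
    simp only [A, A']
    rw [conjDiag_mul hV]
    congr 1; ext i
    rw [Pi.mul_apply, ← suppCpow_add]
    congr 1; push_cast; ring
  have hf : EntireStripBounded f := by
    refine EntireStripBounded.sum _ fun i => ?_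
    simp only [Matrix.diag_apply]
    refine entireStripBounded_matrix_mul (entireStripBounded_matrix_mul
      (entireStripBounded_matrix_mul ?_ ?_) ?_) ?_ i i
    all_goals exact entireStripBounded_conjDiag _ fun i => entireStripBounded_suppCpow _ _ _
  -- On `Re z = 0` the matrices `B z` and `A z` are contractions.
  have hleft : ∀ z ∈ Complex.re ⁻¹' {(0 : ℝ)}, ‖f z‖ ≤ T := by
    intro z hz
    have hz : z.re = 0 := hz
    refine (norm_trace_contraction_mul_le hV hW hY (fun i => norm_suppCpow_le_one _ (by simp [hz]))
      (fun i => norm_suppCpow_le_one _ (by simp [hz]))).trans (le_of_eq ?_)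
    refine Finset.sum_congr rfl fun i _ => ?_
    simp only [D]
    rw [norm_suppCpow (hh i) (by simp [hz, hp0])]
    simp [hz]
  -- On `Re z = 1` the matrix `H^{p(1-z)}` is a contraction.
  have hright : ∀ z ∈ Complex.re ⁻¹' {(1 : ℝ)}, ‖f z‖ ≤ L := by
    intro z hz
    have hz : z.re = 1 := hz
    have h1 : f z = ((Yᴴ * B z * A' z) * (A' z * B z * Y) * Matrix.diagonal (D z)).trace := by
      simp only [f]
      rw [hAA, conjDiag, ← mul_assoc, Matrix.trace_mul_comm]
      simp only [mul_assoc]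
    have hsq : ∀ (x : n → ℝ), (∀ i, 0 ≤ x i) →
        ((fun i => suppCpow (x i) ((p / 2 : ℝ) * z + (0 : ℝ))) *
          star (fun i => suppCpow (x i) ((p / 2 : ℝ) * z + (0 : ℝ))) : n → ℂ) =
        fun i => ((x i ^ p : ℝ) : ℂ) := by
      intro x hx
      ext i
      rw [Pi.mul_apply, Pi.star_apply, RCLike.star_def, Complex.mul_conj,
        Complex.normSq_eq_norm_sq, norm_suppCpow (hx i) (by simp [hz, hp0]),
        ← Real.rpow_natCast, ← Real.rpow_mul (hx i)]
      simp [hz]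
    have hBB : B z * (B z)ᴴ = conjDiag W (fun i => ((b i ^ p : ℝ) : ℂ)) := by
      simp only [B]
      rw [conjDiag_conjTranspose, conjDiag_mul hW, hsq b hb]
    have hBB' : (B z)ᴴ * B z = conjDiag W (fun i => ((b i ^ p : ℝ) : ℂ)) := by
      simp only [B]
      rw [conjDiag_conjTranspose, conjDiag_mul hW, mul_comm, hsq b hb]
    have hAA1 : A' z * (A' z)ᴴ = conjDiag V (fun i => ((a i ^ p : ℝ) : ℂ)) := by
      simp only [A']
      rw [conjDiag_conjTranspose, conjDiag_mul hV, hsq a ha]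
    have hAA2 : (A' z)ᴴ * A' z = conjDiag V (fun i => ((a i ^ p : ℝ) : ℂ)) := by
      simp only [A']
      rw [conjDiag_conjTranspose, conjDiag_mul hV, mul_comm, hsq a ha]
    have hYY := unitary_mul_conjTranspose hY
    rw [h1]
    refine norm_trace_mul_diagonal_le _ _ (fun i => norm_suppCpow_le_one _ (by simp [hz])) ?_ ?_
    · calc ((Yᴴ * B z * A' z) * (Yᴴ * B z * A' z)ᴴ).trace.re
          = (Yᴴ * (B z * (A' z * (A' z)ᴴ) * (B z)ᴴ * Y)).trace.re := by
            simp only [Matrix.conjTranspose_mul, Matrix.conjTranspose_conjTranspose, mul_assoc]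
        _ = ((B z * (A' z * (A' z)ᴴ)) * ((B z)ᴴ * (Y * Yᴴ))).trace.re := by
            rw [Matrix.trace_mul_comm]; simp only [mul_assoc]
        _ = ((A' z * (A' z)ᴴ) * ((B z)ᴴ * B z)).trace.re := by
            rw [hYY, mul_one, Matrix.trace_mul_comm, ← mul_assoc, Matrix.trace_mul_comm]
        _ = L := by rw [hAA1, hBB', hL]
    · calc ((A' z * B z * Y) * (A' z * B z * Y)ᴴ).trace.re
          = (A' z * (B z * (Y * Yᴴ) * (B z)ᴴ * (A' z)ᴴ)).trace.re := by
            simp only [Matrix.conjTranspose_mul, mul_assoc]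
        _ = (((A' z)ᴴ * A' z) * (B z * (B z)ᴴ)).trace.re := by
            rw [hYY, mul_one, Matrix.trace_mul_comm, mul_assoc, Matrix.trace_mul_comm]
        _ = L := by rw [hAA2, hBB, hL]
  have hmem : ((1 / p : ℝ) : ℂ) ∈ Complex.HadamardThreeLines.verticalClosedStrip 0 1 := by
    rw [Complex.HadamardThreeLines.verticalClosedStrip, Set.mem_preimage, Complex.ofReal_re,
      Set.mem_Icc]
    exact ⟨by positivity, (div_le_one hp0).mpr hp⟩
  obtain ⟨C, hC⟩ := hf.2
  have hthree := Complex.HadamardThreeLines.norm_le_interp_of_mem_verticalClosedStrip₀₁' f hmem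
    hf.1.diffContOnCl ⟨C, by rintro _ ⟨z, hz, rfl⟩; exact hC z hz⟩ hleft hright
  -- At `z = 1/p` the function is `Tr H · H^{p-1} = Tr H^p`.
  have hval : f ((1 / p : ℝ) : ℂ) = (T : ℂ) := by
    have hB : B ((1 / p : ℝ) : ℂ) = conjDiag W (fun i => ((b i ^ (1 / 2 : ℝ) : ℝ) : ℂ)) := by
      simp only [B]
      congr 1; ext i
      rw [← suppCpow_ofReal (hb i) (by norm_num)]
      congr 1
      rw [← Complex.ofReal_mul, ← Complex.ofReal_add]
      congr 1; field_simp; ring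
    have hA : A ((1 / p : ℝ) : ℂ) = conjDiag V (fun i => (a i : ℂ)) := by
      simp only [A]
      congr 1; ext i
      rw [← Complex.ofReal_mul, ← Complex.ofReal_add, mul_one_div_cancel hp0.ne', add_zero,
        suppCpow_ofReal (ha i) one_pos, Real.rpow_one]
    simp only [f]
    rw [hB, hA, hH, conjDiag_mul hY, conjDiag_trace hY, hT, Complex.ofReal_sum]
    refine Finset.sum_congr rfl fun i _ => ?_
    rw [Pi.mul_apply, ← suppCpow_ofReal (hh i) hp0]
    have h1 : (h i : ℂ) = suppCpow (h i) (1 : ℝ) := by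
      rw [suppCpow_ofReal (hh i) one_pos, Real.rpow_one]
    simp only [D]
    rw [h1, ← suppCpow_add]
    congr 1
    push_cast
    have : (p : ℂ) ≠ 0 := by exact_mod_cast hp0.ne'
    field_simp
    ring
  rw [hval, Complex.norm_real, Real.norm_of_nonneg hT0, Complex.ofReal_re] at hthree
  have hL0 : 0 ≤ L := (norm_nonneg _).trans (hright 1 (by simp))
  rcases hT0.eq_or_lt with hT1 | hT1
  · rw [← hT1]; exact hL0
  · have h2 : T ^ (1 - 1 / p) * T ^ (1 / p) = T := by
      rw [← Real.rpow_add hT1]; simp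
    have h3 : T ^ (1 / p) ≤ L ^ (1 / p) := by
      have h4 : T ^ (1 - 1 / p) * T ^ (1 / p) ≤ T ^ (1 - 1 / p) * L ^ (1 / p) := by
        rw [h2]; exact hthree
      exact le_of_mul_le_mul_left h4 (Real.rpow_pos_of_pos hT1 _)
    exact (Real.rpow_le_rpow_iff hT0 hL0 (by positivity)).mp h3

end LiebThirring

/-! ### Mixtures of a matrix with its reflection -/

section ReflectionMixture

/-- The scalar case of `rpow_trace_reflection_mix_le`, by convexity of the power. -/
theorem rpow_mix_add_le {s t x p : ℝ} (hs : 0 ≤ s) (ht : 0 ≤ t) (hx : 0 ≤ x) (hx1 : x ≤ 1)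
    (hp : 1 ≤ p) :
    (s * x + t * (1 - x)) ^ p + (s * (1 - x) + t * (1 - (1 - x))) ^ p ≤ s ^ p + t ^ p := by
  have h1 := (convexOn_rpow hp).2 (Set.mem_Ici.mpr hs) (Set.mem_Ici.mpr ht) hx
    (sub_nonneg.mpr hx1) (by ring)
  have h2 := (convexOn_rpow hp).2 (Set.mem_Ici.mpr hs) (Set.mem_Ici.mpr ht)
    (sub_nonneg.mpr hx1) hx (by ring)
  simp only [smul_eq_mul] at h1 h2
  rw [show s * x + t * (1 - x) = x * s + (1 - x) * t by ring,
    show s * (1 - x) + t * (1 - (1 - x)) = (1 - x) * s + x * t by ring]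
  linarith

variable {n : Type*} [Fintype n]

theorem posSemidef_of_add_eq_zero {A B : Matrix n n ℂ} (hA : A.PosSemidef) (hB : B.PosSemidef)
    (h : A + B = 0) : A = 0 := by
  have h1 := hA.trace_nonneg
  have h2 := hB.trace_nonneg
  have h3 : A.trace + B.trace = 0 := by rw [← Matrix.trace_add, h, Matrix.trace_zero]
  exact hA.trace_eq_zero_iff.mp (le_antisymm (by rw [← h3]; exact le_add_of_nonneg_right h2) h1)

variable [DecidableEq n]

theorem posSemidef_mul_eq_zero {A C : Matrix n n ℂ} (hA : A.PosSemidef) (h : Cᴴ * A * C = 0) :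
    A * C = 0 := by
  obtain ⟨B, rfl⟩ := CStarAlgebra.nonneg_iff_eq_star_mul_self.mp
    (Matrix.nonneg_iff_posSemidef.mpr hA)
  rw [Matrix.star_eq_conjTranspose] at *
  have h1 : (B * C)ᴴ * (B * C) = 0 := by
    rw [Matrix.conjTranspose_mul, ← h]; simp only [mul_assoc]
  rw [mul_assoc, Matrix.conjTranspose_mul_self_eq_zero.mp h1, mul_zero]

/-- If `D ≤ c` for a diagonalized matrix `D`, then `Tr D P ≤ c Tr P` for `P ≥ 0`. -/
theorem trace_conjDiag_mul_le {V P : Matrix n n ℂ} (hV : V ∈ Matrix.unitaryGroup n ℂ)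
    (hP : P.PosSemidef) {d : n → ℝ} {c : ℝ} (hd : ∀ i, d i ≤ c) :
    (conjDiag V (fun i => (d i : ℂ)) * P).trace.re ≤ c * P.trace.re := by
  have h1 : ∀ e : n → ℂ, (conjDiag V e * P).trace = ∑ i, e i * (Vᴴ * P * V) i i := by
    intro e
    have h2 : (conjDiag V e * P).trace = (Matrix.diagonal e * (Vᴴ * P * V)).trace := by
      rw [conjDiag, mul_assoc, mul_assoc, Matrix.trace_mul_comm]
      simp only [mul_assoc]
    rw [h2, Matrix.trace]
    simp [Matrix.diagonal_mul]
  have h3 : P.trace = ∑ i, (Vᴴ * P * V) i i := by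
    have := h1 1
    rw [conjDiag_one hV, one_mul] at this
    simpa using this
  have hpos : (Vᴴ * P * V).PosSemidef := hP.conjTranspose_mul_mul_same V
  rw [h1, h3, Complex.re_sum, Complex.re_sum, Finset.mul_sum]
  refine Finset.sum_le_sum fun i _ => ?_
  rw [Complex.re_ofReal_mul]
  exact mul_le_mul_of_nonneg_right (hd i) (Complex.nonneg_iff.mp (hpos.diag_nonneg (i := i))).1

/-- Let `Z` be a reflection. With `S = ρ + ZρZ` one can write `ρ = S^{1/2} x S^{1/2}` with
`0 ≤ x ≤ 1` and `ZxZ = 1 - x`. The Lieb–Thirring inequality then replaces `sρ + tZρZ` by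
`S^p (s x + t (1 - x))^p`, and averaging over the conjugation by `Z`, which fixes `S` and exchanges
`x` and `1 - x`, leaves a scalar convexity inequality. -/
theorem rpow_trace_reflection_mix_le {ρ Z : Matrix n n ℂ} (hρ : ρ.PosSemidef) (hZ : Zᴴ = Z)
    (hZZ : Z * Z = 1) {s t p : ℝ} (hs : 0 ≤ s) (ht : 0 ≤ t) (hp : 1 ≤ p) :
    (((s : ℂ) • ρ + (t : ℂ) • (Z * ρ * Z)) ^ p).trace.re ≤
      (s ^ p + t ^ p) / 2 * ((ρ + Z * ρ * Z) ^ p).trace.re := by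
  have hZu : Z ∈ Matrix.unitaryGroup n ℂ := by
    rw [Matrix.mem_unitaryGroup_iff, Matrix.star_eq_conjTranspose, hZ, hZZ]
  have hZρ : (Z * ρ * Z).PosSemidef := by
    simpa [hZ] using hρ.mul_mul_conjTranspose_same Z
  obtain ⟨W, hW, b, hb, hS⟩ := posSemidef_exists_conjDiag (hρ.add hZρ)
  set S := ρ + Z * ρ * Z with hSdef
  have hZSZ : Z * S * Z = S := by
    have : Z * (Z * ρ * Z) * Z = (Z * Z) * ρ * (Z * Z) := by simp only [mul_assoc]
    rw [hSdef, mul_add, add_mul, this, hZZ, one_mul, mul_one, add_comm]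
  -- Functions of `S` are invariant under conjugation by `Z`.
  have hZf : ∀ f : ℝ → ℂ,
      Z * conjDiag W (fun i => f (b i)) * Z = conjDiag W (fun i => f (b i)) := by
    intro f
    have h1 : conjDiag (Z * W) (fun i => (b i : ℂ)) = conjDiag W (fun i => (b i : ℂ)) := by
      rw [← conj_conjDiag, ← hS, hZ, hZSZ]
    have h2 := conjDiag_map_congr (mul_mem hZu hW) hW f h1
    rw [← conj_conjDiag, hZ] at h2
    exact h2
  set R := conjDiag W (fun i => ((b i ^ (-(1 / 2) : ℝ) : ℝ) : ℂ)) with hR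
  set Q := conjDiag W (fun i => ((b i ^ (1 / 2 : ℝ) : ℝ) : ℂ)) with hQ
  set P := conjDiag W (fun i => if b i = 0 then (0 : ℂ) else 1) with hPdef
  have hRH : Rᴴ = R := by
    rw [hR, conjDiag_conjTranspose]; congr 1; ext i; simp
  have hPH : Pᴴ = P := by
    rw [hPdef, conjDiag_conjTranspose]; congr 1; ext i
    simp only [Pi.star_apply]; split_ifs <;> simp
  have hRQ : R * Q = P := by
    rw [hR, hQ, conjDiag_mul hW, hPdef]; congr 1; ext i
    rw [Pi.mul_apply, ← Complex.ofReal_mul]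
    split_ifs with h
    · simp [h]
    · rw [← Real.rpow_add (lt_of_le_of_ne (hb i) (Ne.symm h))]; simp
  have hQR : Q * R = P := by
    rw [← hRQ, hR, hQ, conjDiag_mul hW, conjDiag_mul hW, mul_comm]
  have hPP : P * P = P := by
    rw [hPdef, conjDiag_mul hW]; congr 1; ext i; simp
  have hQP : Q * P = Q := by
    rw [hPdef, hQ, conjDiag_mul hW]; congr 1; ext i
    rw [Pi.mul_apply]; split_ifs with h
    · simp [h]
    · simp
  have hSP : S * P = S := by
    rw [hS, hPdef, conjDiag_mul hW]; congr 1; ext i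
    rw [Pi.mul_apply]; split_ifs with h
    · simp [h]
    · simp
  have hRSR : R * S * R = P := by
    have h1 : S = Q * Q := by
      rw [hS, hQ, conjDiag_mul hW]; congr 1; ext i
      rw [Pi.mul_apply, ← Complex.ofReal_mul, ← Real.sqrt_eq_rpow, Real.mul_self_sqrt (hb i)]
    rw [h1, show R * (Q * Q) * R = (R * Q) * (Q * R) by simp only [mul_assoc], hRQ, hQR, hPP]
  -- The support of `ρ` lies in the support of `S`.
  have hρP : ρ * (1 - P) = 0 := by
    apply posSemidef_mul_eq_zero hρ
    refine posSemidef_of_add_eq_zero (hρ.conjTranspose_mul_mul_same _)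
      (hZρ.conjTranspose_mul_mul_same (1 - P)) ?_
    rw [← add_mul, ← mul_add, ← hSdef, mul_assoc, mul_sub, mul_one, hSP, sub_self, mul_zero]
  have hρP1 : ρ * P = ρ := by
    rw [mul_sub, mul_one, sub_eq_zero] at hρP; exact hρP.symm
  have hρP2 : P * ρ = ρ := by
    have h := congrArg Matrix.conjTranspose hρP1
    rwa [Matrix.conjTranspose_mul, hPH, hρ.1.eq] at h
  have hPpos : (1 - P).PosSemidef := by
    have h1 : 1 - P = (1 - P)ᴴ * (1 - P) := by
      rw [Matrix.conjTranspose_sub, Matrix.conjTranspose_one, hPH, mul_sub, mul_one, sub_mul,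
        one_mul, hPP, sub_self, sub_zero]
    rw [h1]; exact Matrix.posSemidef_conjTranspose_mul_self _
  -- On the kernel of `S` the factor `x` is completed by `1/2`, to keep `x + ZxZ = 1`.
  set X := R * ρ * R + (1 / 2 : ℂ) • (1 - P) with hX
  have hXpos : X.PosSemidef := by
    refine Matrix.PosSemidef.add ?_ (hPpos.smul ?_)
    · have := hρ.mul_mul_conjTranspose_same R
      rwa [hRH] at this
    · rw [one_div, ← Complex.ofReal_ofNat, ← Complex.ofReal_inv, Complex.zero_le_real]
      norm_num
  have hZR : Z * R * Z = R := hZf fun u => ((u ^ (-(1 / 2) : ℝ) : ℝ) : ℂ)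
  have hZQ : Z * Q * Z = Q := hZf fun u => ((u ^ (1 / 2 : ℝ) : ℝ) : ℂ)
  have hZP : Z * P * Z = P := hZf fun u => if u = 0 then (0 : ℂ) else 1
  have hcomm : ∀ {M : Matrix n n ℂ}, Z * M * Z = M → Z * M = M * Z := by
    intro M h
    calc Z * M = Z * M * (Z * Z) := by rw [hZZ, mul_one]
      _ = (Z * M * Z) * Z := by simp only [mul_assoc]
      _ = M * Z := by rw [h]
  have hZXZ : Z * X * Z = 1 - X := by
    have h1 : Z * (R * ρ * R) * Z = R * (Z * ρ * Z) * R := by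
      calc Z * (R * ρ * R) * Z = (Z * R) * ρ * (R * Z) := by simp only [mul_assoc]
        _ = (R * Z) * ρ * (Z * R) := by rw [hcomm hZR]
        _ = R * (Z * ρ * Z) * R := by simp only [mul_assoc]
    have h2 : Z * (1 - P) * Z = 1 - P := by
      rw [mul_sub, sub_mul, hZP, mul_one, hZZ]
    have h3 : R * ρ * R + R * (Z * ρ * Z) * R = P := by
      rw [← add_mul, ← mul_add, ← hSdef, hRSR]
    have h4 : (1 / 2 : ℂ) • (1 - P) + (1 / 2 : ℂ) • (1 - P) = 1 - P := by
      rw [← add_smul]; norm_num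
    rw [hX, mul_add, add_mul, h1, mul_smul_comm, smul_mul_assoc, h2, eq_sub_iff_add_eq]
    calc _ = (R * ρ * R + R * (Z * ρ * Z) * R) +
          ((1 / 2 : ℂ) • (1 - P) + (1 / 2 : ℂ) • (1 - P)) := by abel
      _ = 1 := by rw [h3, h4]; abel
  obtain ⟨V, hV, x, hx, hXV⟩ := posSemidef_exists_conjDiag hXpos
  have h1X : conjDiag V (fun i => ((1 - x i : ℝ) : ℂ)) = 1 - X := by
    rw [eq_sub_iff_add_eq, hXV, ← conjDiag_add, ← conjDiag_one hV]
    congr 1; ext i; simp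
  have hx1 : ∀ i, x i ≤ 1 := by
    intro i
    have h1 : (1 - X).PosSemidef := by
      rw [← hZXZ]; simpa [hZ] using hXpos.mul_mul_conjTranspose_same Z
    have h2 := (h1.conjTranspose_mul_mul_same V).diag_nonneg (i := i)
    have h3 : Vᴴ * (1 - X) * V = Matrix.diagonal fun i => ((1 - x i : ℝ) : ℂ) := by
      rw [← h1X]
      have := conj_conjDiag Vᴴ V fun i => ((1 - x i : ℝ) : ℂ)
      rw [Matrix.conjTranspose_conjTranspose, unitary_conjTranspose_mul hV] at this
      rw [this]; simp [conjDiag]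
    rw [h3, Matrix.diagonal_apply_eq] at h2
    have := (Complex.nonneg_iff.mp h2).1
    rw [Complex.ofReal_re] at this
    linarith
  have hQXQ : Q * X * Q = ρ := by
    have h1 : Q * (R * ρ * R) * Q = (Q * R) * ρ * (R * Q) := by simp only [mul_assoc]
    rw [hX, mul_add, add_mul, h1, hQR, hRQ, hρP2, hρP1, mul_smul_comm, smul_mul_assoc, mul_sub,
      mul_one, hQP, sub_self, zero_mul, smul_zero, add_zero]
  have hQXQ' : Q * (1 - X) * Q = Z * ρ * Z := by
    rw [← hZXZ]
    calc Q * (Z * X * Z) * Q = (Q * Z) * X * (Z * Q) := by simp only [mul_assoc]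
      _ = (Z * Q) * X * (Q * Z) := by rw [hcomm hZQ]
      _ = Z * (Q * X * Q) * Z := by simp only [mul_assoc]
      _ = _ := by rw [hQXQ]
  -- Replace `x` and `1 - x` by scalars: `s x + t (1 - x) = g(x)` in an eigenbasis of `x`.
  let g : ℝ → ℝ := fun u => s * u + t * (1 - u)
  have hg : ∀ i, 0 ≤ g (x i) := fun i =>
    add_nonneg (mul_nonneg hs (hx i)) (mul_nonneg ht (sub_nonneg.mpr (hx1 i)))
  have hG : conjDiag V (fun i => (g (x i) : ℂ)) = (s : ℂ) • X + (t : ℂ) • (1 - X) := by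
    rw [← h1X, hXV, ← conjDiag_smul, ← conjDiag_smul, ← conjDiag_add]
    congr 1; ext i; simp [g]
  have hmix : Q * conjDiag V (fun i => (g (x i) : ℂ)) * Q =
      (s : ℂ) • ρ + (t : ℂ) • (Z * ρ * Z) := by
    rw [hG, mul_add, add_mul, mul_smul_comm, mul_smul_comm, smul_mul_assoc, smul_mul_assoc, hQXQ,
      hQXQ']
  obtain ⟨Y, hY, h, hh, hYh⟩ := posSemidef_exists_conjDiag
    ((hρ.smul (by simpa using hs : (0 : ℂ) ≤ s)).add (hZρ.smul (by simpa using ht : (0 : ℂ) ≤ t)))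
  have hLT := lieb_thirring hV hW hY hg hb hh (hmix.trans hYh) hp
  set E := conjDiag V (fun i => ((g (x i) ^ p : ℝ) : ℂ)) with hE
  set Sp := conjDiag W (fun i => ((b i ^ p : ℝ) : ℂ)) with hSp
  have hSpos : Sp.PosSemidef := conjDiag_posSemidef W fun i => Real.rpow_nonneg (hb i) p
  have hZSp : Z * Sp * Z = Sp := hZf fun u => ((u ^ p : ℝ) : ℂ)
  have hZE : Z * E * Z = conjDiag V (fun i => ((g (1 - x i) ^ p : ℝ) : ℂ)) := by
    have h1 : conjDiag V (fun i => ((1 - x i : ℝ) : ℂ)) =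
        conjDiag (Z * V) (fun i => (x i : ℂ)) := by
      rw [h1X, ← hZXZ, ← conj_conjDiag, hZ, ← hXV]
    have h2 := conjDiag_map_congr hV (mul_mem hZu hV) (fun u => ((g u ^ p : ℝ) : ℂ)) h1
    rw [← conj_conjDiag, hZ] at h2
    exact h2.symm
  have hsym : (E * Sp).trace = (Z * E * Z * Sp).trace := by
    calc (E * Sp).trace = (E * (Z * Sp * Z)).trace := by rw [hZSp]
      _ = ((E * Z * Sp) * Z).trace := by simp only [mul_assoc]
      _ = _ := by rw [Matrix.trace_mul_comm]; simp only [mul_assoc]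
  -- The average over `Z` of `Tr g(x)^p S^p`.
  have hsum : (E * Sp).trace.re + (E * Sp).trace.re ≤ (s ^ p + t ^ p) * Sp.trace.re := by
    nth_rw 2 [hsym]
    rw [← Complex.add_re, ← Matrix.trace_add, ← add_mul, hZE, hE, ← conjDiag_add]
    have h1 := trace_conjDiag_mul_le hV hSpos (d := fun i => g (x i) ^ p + g (1 - x i) ^ p)
      (c := s ^ p + t ^ p) (fun i => rpow_mix_add_le hs ht (hx i) (hx1 i) hp)
    refine le_trans (le_of_eq ?_) h1
    congr 4; ext i; simp
  rw [hYh, rpow_conjDiag hY hh, conjDiag_trace hY, ← Complex.ofReal_sum, Complex.ofReal_re, hS,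
    rpow_conjDiag hW hb]
  linarith

end ReflectionMixture

/-! ### Phase-damping channels -/

section PhaseDamping

variable {K : ℕ}

theorem mFun_nonneg {p x : ℝ} (hx : |x| ≤ 1) : 0 ≤ mFun p x := by
  have := abs_le.mp hx
  exact Real.rpow_nonneg (add_nonneg (Real.rpow_nonneg (by linarith) _)
    (Real.rpow_nonneg (by linarith) _)) _

/-- The reflection `1 ⊗ σ₃`. -/
def tensorPauliThree (K : ℕ) : Matrix (Fin K × Fin 2) (Fin K × Fin 2) ℂ :=
  Matrix.diagonal fun x => if x.2 = 0 then 1 else -1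

theorem tensorPauliThree_conjTranspose (K : ℕ) :
    (tensorPauliThree K)ᴴ = tensorPauliThree K := by
  rw [tensorPauliThree, Matrix.diagonal_conjTranspose]
  congr 1; ext x
  simp only [Pi.star_apply]
  split_ifs <;> simp

theorem tensorPauliThree_mul_self (K : ℕ) : tensorPauliThree K * tensorPauliThree K = 1 := by
  rw [tensorPauliThree, Matrix.diagonal_mul_diagonal, ← Matrix.diagonal_one]
  congr 1; ext x
  split_ifs <;> simp

theorem idTensor_phaseDamping (t : ℝ) (ρ : Matrix (Fin K × Fin 2) (Fin K × Fin 2) ℂ) :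
    idTensor (phaseDamping t) ρ = (((1 + t) / 2 : ℝ) : ℂ) • ρ +
      (((1 - t) / 2 : ℝ) : ℂ) • (tensorPauliThree K * ρ * tensorPauliThree K) := by
  ext ⟨k, a⟩ ⟨l, b⟩
  rw [tensorPauliThree, Matrix.add_apply, Matrix.smul_apply, Matrix.smul_apply,
    Matrix.mul_diagonal, Matrix.diagonal_mul]
  fin_cases a <;> fin_cases b <;> simp [idTensor, phaseDamping] <;> ring

theorem idTensor_phaseDamping_posSemidef {t : ℝ} (ht : |t| ≤ 1)
    {ρ : Matrix (Fin K × Fin 2) (Fin K × Fin 2) ℂ} (hρ : ρ.PosSemidef) :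
    (idTensor (phaseDamping t) ρ).PosSemidef := by
  have h := abs_le.mp ht
  have hZ := hρ.mul_mul_conjTranspose_same (tensorPauliThree K)
  rw [tensorPauliThree_conjTranspose] at hZ
  rw [idTensor_phaseDamping]
  refine (hρ.smul ?_).add (hZ.smul ?_)
  · rw [Complex.zero_le_real]; linarith
  · rw [Complex.zero_le_real]; linarith

/-- Among the half-noisy phase-damping channels, `Ψ_t` is controlled by `Ψ_0`. -/
theorem pNorm_idTensor_phaseDamping_le {t : ℝ} (ht : |t| ≤ 1)
    {ρ : Matrix (Fin K × Fin 2) (Fin K × Fin 2) ℂ} (hρ : ρ.PosSemidef) {p : ℝ} (hp : 1 ≤ p) :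
    pNorm p (idTensor (phaseDamping t) ρ) ≤
      (mFun p 0)⁻¹ * mFun p t * pNorm p (idTensor (phaseDamping 0) ρ) := by
  have h := abs_le.mp ht
  have hp0 : 0 < p := by linarith
  have hs : 0 ≤ (1 + t) / 2 := by linarith
  have hr : 0 ≤ (1 - t) / 2 := by linarith
  have hZ := hρ.mul_mul_conjTranspose_same (tensorPauliThree K)
  rw [tensorPauliThree_conjTranspose] at hZ
  have hS := hρ.add hZ
  have h0 : idTensor (phaseDamping 0) ρ = ((1 / 2 : ℝ) : ℂ) •
      (ρ + tensorPauliThree K * ρ * tensorPauliThree K) := by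
    rw [idTensor_phaseDamping, smul_add]; norm_num
  have hm0 : mFun p 0 = 2 ^ (1 / p) * (1 / 2) := by
    rw [mFun, add_zero, sub_zero, ← two_mul, Real.mul_rpow (by norm_num) (by positivity),
      ← Real.rpow_mul (by norm_num), mul_one_div_cancel hp0.ne', Real.rpow_one]
  have hA : 0 ≤ ((1 + t) / 2) ^ p + ((1 - t) / 2) ^ p :=
    add_nonneg (Real.rpow_nonneg hs _) (Real.rpow_nonneg hr _)
  have key : pNorm p (idTensor (phaseDamping t) ρ) ≤
      mFun p t / 2 ^ (1 / p) * pNorm p (ρ + tensorPauliThree K * ρ * tensorPauliThree K) := by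
    rw [mFun, ← Real.div_rpow hA (by norm_num), pNorm, pNorm,
      ← Real.mul_rpow (div_nonneg hA (by norm_num)) (rpow_trace_nonneg hS p)]
    refine Real.rpow_le_rpow
      (rpow_trace_nonneg (idTensor_phaseDamping_posSemidef ht hρ) p) ?_ (by positivity)
    rw [idTensor_phaseDamping]
    exact rpow_trace_reflection_mix_le hρ (tensorPauliThree_conjTranspose K)
      (tensorPauliThree_mul_self K) hs hr hp
  rw [h0, pNorm_smul hS (by norm_num) hp, hm0]
  refine key.trans (le_of_eq ?_)
  have : (2 : ℝ) ^ (1 / p) ≠ 0 := by positivity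
  field_simp

end PhaseDamping

/-! ### Mixtures of quadratic forms on `ℝ⁴` -/

section ConvexHull

/-- By Carathéodory's theorem, the convex hull of a compact set in finite dimension is a continuous
image of the product of a simplex with a power of the set. -/
theorem isCompact_convexHull_of_finiteDimensional {E : Type*} [NormedAddCommGroup E]
    [NormedSpace ℝ E] [FiniteDimensional ℝ E] {s : Set E} (hs : IsCompact s) :
    IsCompact (convexHull ℝ s) := by
  rcases s.eq_empty_or_nonempty with rfl | ⟨x₀, hx₀⟩
  · simp
  let m := Module.finrank ℝ E + 1
  let F : (Fin m → ℝ) × (Fin m → E) → E := fun q => ∑ i, q.1 i • q.2 i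
  have hF : Continuous F := by fun_prop
  have hK : IsCompact (stdSimplex ℝ (Fin m) ×ˢ Set.univ.pi fun _ : Fin m => s) :=
    (isCompact_stdSimplex ℝ (Fin m)).prod (isCompact_univ_pi fun _ => hs)
  have himage : convexHull ℝ s = F '' (stdSimplex ℝ (Fin m) ×ˢ Set.univ.pi fun _ : Fin m => s) := by
    apply Set.Subset.antisymm
    · intro x hx
      obtain ⟨ι, _, z, w, hz, hind, hw, hw1, rfl⟩ := eq_pos_convex_span_of_mem_convexHull hx
      have hcard : Fintype.card ι ≤ Fintype.card (Fin m) := by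
        rw [Fintype.card_fin]
        exact hind.card_le_finrank_succ.trans (Nat.succ_le_succ (Submodule.finrank_le _))
      obtain ⟨e⟩ := Function.Embedding.nonempty_of_card_le hcard
      have hsum : ∀ (g : Fin m → E) (h : ι → E), (∀ i, g (e i) = h i) →
          (∀ j, j ∉ Set.range e → g j = 0) → ∑ j, g j = ∑ i, h i := by
        intro g h h1 h2
        exact (Finset.sum_of_injOn e e.injective.injOn
          (fun _ _ => Finset.mem_coe.mpr (Finset.mem_univ _))
          (fun j _ hj => h2 j (by simpa using hj)) (fun i _ => (h1 i).symm)).symm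
      have hsum' : ∑ j, Function.extend e w 0 j = ∑ i, w i :=
        (Finset.sum_of_injOn e e.injective.injOn
          (fun _ _ => Finset.mem_coe.mpr (Finset.mem_univ _))
          (fun j _ hj => Function.extend_apply' w (0 : Fin m → ℝ) j (by simpa using hj))
          (fun i _ => (e.injective.extend_apply w 0 i).symm)).symm
      refine ⟨(Function.extend e w 0, Function.extend e z fun _ => x₀), ⟨⟨fun j => ?_, ?_⟩, ?_⟩, ?_⟩
      · by_cases hj : ∃ i, e i = j
        · obtain ⟨i, rfl⟩ := hj
          simpa only [e.injective.extend_apply] using (hw i).le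
        · simp [Function.extend_apply' _ _ _ hj]
      · rw [hsum', hw1]
      · intro j _
        by_cases hj : ∃ i, e i = j
        · obtain ⟨i, rfl⟩ := hj
          simpa only [e.injective.extend_apply] using hz ⟨i, rfl⟩
        · simpa [Function.extend_apply' _ _ _ hj] using hx₀
      · refine hsum _ _ (fun i => ?_) fun j hj => ?_
        · simp only [e.injective.extend_apply]
        · simp [Function.extend_apply' _ _ _ hj]
    · rintro _ ⟨⟨w, z⟩, ⟨hw, hz⟩, rfl⟩
      exact mem_convexHull_of_exists_fintype w z hw.1 hw.2 (fun i => hz i trivial) rfl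
  rw [himage]
  exact hK.image hF

/-- The quadratic form `∑ M i j u i u j` of a `4 × 4` array. -/
def quadForm (M : Fin 4 → Fin 4 → ℝ) (u : Fin 4 → ℝ) : ℝ :=
  ∑ i, ∑ j, M i j * (u i * u j)

/-- Unit vectors `u`, `v` such that `v` is orthogonal to `u` and to `J u`. For a complex structure
`J` on `ℝ⁴` this says that `u` and `v` are orthogonal in `ℂ²`. -/
def orthoPairs (J : (Fin 4 → ℝ) → Fin 4 → ℝ) : Set ((Fin 4 → ℝ) × (Fin 4 → ℝ)) :=
  {q | q.1 ⬝ᵥ q.1 = 1 ∧ q.2 ⬝ᵥ q.2 = 1 ∧ q.2 ⬝ᵥ q.1 = 0 ∧ q.2 ⬝ᵥ J q.1 = 0}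

theorem mem_Icc_of_dotProduct_self_eq_one {ι : Type*} [Fintype ι] {u : ι → ℝ}
    (hu : u ⬝ᵥ u = 1) : u ∈ Set.Icc (fun _ => (-1 : ℝ)) fun _ => 1 := by
  have h : ∀ i, u i ^ 2 ≤ 1 := by
    intro i
    rw [← hu, dotProduct, sq]
    exact Finset.single_le_sum (f := fun i => u i * u i) (fun j _ => mul_self_nonneg _)
      (Finset.mem_univ i)
  exact ⟨fun i => (abs_le.mp ((sq_le_one_iff_abs_le_one _).mp (h i))).1,
    fun i => (abs_le.mp ((sq_le_one_iff_abs_le_one _).mp (h i))).2⟩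

theorem isCompact_orthoPairs {J : (Fin 4 → ℝ) → Fin 4 → ℝ} (hJ : Continuous J) :
    IsCompact (orthoPairs J) := by
  have hclosed : IsClosed (orthoPairs J) := by
    have hdot : ∀ {f g : (Fin 4 → ℝ) × (Fin 4 → ℝ) → Fin 4 → ℝ} (c : ℝ), Continuous f →
        Continuous g → IsClosed {q | f q ⬝ᵥ g q = c} := fun c hf hg =>
      isClosed_eq (hf.dotProduct hg) continuous_const
    exact (hdot 1 continuous_fst continuous_fst).inter
      ((hdot 1 continuous_snd continuous_snd).inter ((hdot 0 continuous_snd continuous_fst).inter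
        (hdot 0 continuous_snd (hJ.comp continuous_fst))))
  exact (isCompact_Icc.prod isCompact_Icc).of_isClosed_subset hclosed
    fun q hq => ⟨mem_Icc_of_dotProduct_self_eq_one hq.1,
      mem_Icc_of_dotProduct_self_eq_one hq.2.1⟩

/-- The spectral theorem for a real symmetric `4 × 4` array, with sorted eigenvalues. -/
theorem exists_sorted_eigenbasis {X : Matrix (Fin 4) (Fin 4) ℝ} (hX : X.IsHermitian) :
    ∃ (x : Fin 4 → ℝ) (w : Fin 4 → Fin 4 → ℝ), Monotone x ∧
      (∀ k l, w k ⬝ᵥ w l = if k = l then 1 else 0) ∧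
      (∀ i j, ∑ k, w k i * w k j = if i = j then 1 else 0) ∧
      ∀ i j, X i j = ∑ k, x k * (w k i * w k j) := by
  let σ := Tuple.sort hX.eigenvalues
  let P : Matrix (Fin 4) (Fin 4) ℝ := hX.eigenvectorUnitary
  have hP : P ∈ Matrix.unitaryGroup (Fin 4) ℝ := hX.eigenvectorUnitary.2
  have h1 : P * Pᵀ = 1 := by
    have := Matrix.mem_unitaryGroup_iff.mp hP
    rwa [Matrix.star_eq_conjTranspose, Matrix.conjTranspose_eq_transpose_of_trivial] at this
  have h2 : Pᵀ * P = 1 := by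
    have := Matrix.mem_unitaryGroup_iff'.mp hP
    rwa [Matrix.star_eq_conjTranspose, Matrix.conjTranspose_eq_transpose_of_trivial] at this
  have h3 : X = P * Matrix.diagonal hX.eigenvalues * Pᵀ := by
    conv_lhs => rw [hX.spectral_theorem, Unitary.conjStarAlgAut_apply]
    rw [Matrix.star_eq_conjTranspose, Matrix.conjTranspose_eq_transpose_of_trivial]
    rfl
  refine ⟨hX.eigenvalues ∘ σ, fun k i => P i (σ k), Tuple.monotone_sort _, fun k l => ?_,
    fun i j => ?_, fun i j => ?_⟩
  · have := congrFun (congrFun h2 (σ k)) (σ l)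
    rw [Matrix.mul_apply, Matrix.one_apply] at this
    simpa [dotProduct] using this
  · have := congrFun (congrFun h1 i) j
    rw [Matrix.mul_apply, Matrix.one_apply, ← Equiv.sum_comp σ] at this
    exact this
  · conv_lhs => rw [h3, Matrix.mul_apply]
    rw [← Equiv.sum_comp σ]
    refine Finset.sum_congr rfl fun k _ => ?_
    rw [Matrix.mul_diagonal, Matrix.transpose_apply, Function.comp_apply]
    ring

/-- A positive form of trace one on `ℝ⁴` whose value on orthonormal pairs is at most `s` is a
mixture of the forms `s u uᵀ + (1 - s) v vᵀ`, where `v` may even be chosen orthogonal to `J u`.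

By separation, it suffices to bound `Tr X D` for a symmetric `X` with eigenvalues
`x₀ ≤ x₁ ≤ x₂ ≤ x₃`. It is at most `s x₃ + (1 - s) x₁`. Take for `u` the top eigenvector, and for
`v` a vector in the span of the two middle eigenvectors, where there is room to be orthogonal to
`J u`. -/
theorem mem_convexHull_orthoPairs {J : (Fin 4 → ℝ) → Fin 4 → ℝ} (hJ : Continuous J)
    {D : Fin 4 → Fin 4 → ℝ} (hsymm : ∀ i j, D i j = D j i) (hpos : ∀ u, 0 ≤ quadForm D u)
    (htr : ∑ i, D i i = 1) {s : ℝ} (hs : s ≤ 1)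
    (hpair : ∀ u v, u ⬝ᵥ u = 1 → v ⬝ᵥ v = 1 → u ⬝ᵥ v = 0 → quadForm D u + quadForm D v ≤ s) :
    D ∈ convexHull ℝ ((fun q : (Fin 4 → ℝ) × (Fin 4 → ℝ) => fun i j =>
      s * (q.1 i * q.1 j) + (1 - s) * (q.2 i * q.2 j)) '' orthoPairs J) := by
  set S := (fun q : (Fin 4 → ℝ) × (Fin 4 → ℝ) => fun i j =>
      s * (q.1 i * q.1 j) + (1 - s) * (q.2 i * q.2 j)) '' orthoPairs J with hS
  by_contra hD
  have hcompact : IsCompact (convexHull ℝ S) :=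
    isCompact_convexHull_of_finiteDimensional ((isCompact_orthoPairs hJ).image (by fun_prop))
  -- A separating functional `f`; on symmetric arrays it is `M ↦ Tr X M` with `X` symmetric.
  obtain ⟨f, c, hfS, hfD⟩ := geometric_hahn_banach_closed_point (convex_convexHull ℝ S)
    hcompact.isClosed hD
  let e : Fin 4 → Fin 4 → Fin 4 → Fin 4 → ℝ := fun i j => Pi.single i (Pi.single j 1)
  have hf : ∀ M : Fin 4 → Fin 4 → ℝ, f M = ∑ i, ∑ j, M i j * f (e i j) := by
    intro M
    have h1 : M = ∑ i, ∑ j, M i j • e i j := by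
      ext k l
      simp only [Finset.sum_apply, Pi.smul_apply, smul_eq_mul, e]
      rw [Finset.sum_eq_single k, Finset.sum_eq_single l] <;>
        simp +contextual [Pi.single_apply, eq_comm]
    conv_lhs => rw [h1]
    simp only [map_sum, map_smul, smul_eq_mul]
  let X : Matrix (Fin 4) (Fin 4) ℝ := Matrix.of fun i j => (f (e i j) + f (e j i)) / 2
  have hX : X.IsHermitian := by
    ext i j
    simp only [X, Matrix.conjTranspose_apply, Matrix.of_apply, star_trivial]
    ring
  have hfX : ∀ M : Fin 4 → Fin 4 → ℝ, (∀ i j, M i j = M j i) → f M = ∑ i, ∑ j, X i j * M i j := by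
    intro M hM
    have h1 : f M = ∑ i, ∑ j, M i j * f (e j i) := by
      rw [hf M, Finset.sum_comm]
      exact Finset.sum_congr rfl fun i _ => Finset.sum_congr rfl fun j _ => by rw [hM]
    have h2 : f M = (f M + f M) / 2 := by ring
    rw [h2]
    nth_rw 1 [hf M]
    rw [h1, ← Finset.sum_add_distrib, Finset.sum_div]
    refine Finset.sum_congr rfl fun i _ => ?_
    rw [← Finset.sum_add_distrib, Finset.sum_div]
    refine Finset.sum_congr rfl fun j _ => ?_
    simp only [X, Matrix.of_apply]
    ring
  obtain ⟨x, w, hx, hw, hw', hXw⟩ := exists_sorted_eigenbasis hX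
  -- The trace of `X D` in the eigenbasis.
  have hfD' : f D = ∑ k, x k * quadForm D (w k) := by
    rw [hfX D hsymm]
    simp only [hXw, quadForm, Fin.sum_univ_four]
    ring
  have htr' : ∑ k, quadForm D (w k) = 1 := by
    have h1 : ∑ k, quadForm D (w k) = ∑ i, ∑ j, D i j * ∑ k, w k i * w k j := by
      simp only [quadForm, Fin.sum_univ_four]
      ring
    rw [h1, ← htr]
    simp [hw']
  have hXq : ∀ u : Fin 4 → ℝ, quadForm X u = ∑ k, x k * (w k ⬝ᵥ u) ^ 2 := by
    intro u
    simp only [quadForm, hXw, Fin.sum_univ_four, dotProduct]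
    ring
  -- A unit vector in the span of `w 1` and `w 2` which is orthogonal to `J (w 3)`.
  obtain ⟨α, β, hαβ, hJ0⟩ : ∃ α β : ℝ, α ^ 2 + β ^ 2 = 1 ∧
      α * (w 1 ⬝ᵥ J (w 3)) + β * (w 2 ⬝ᵥ J (w 3)) = 0 := by
    set a := w 1 ⬝ᵥ J (w 3)
    set b := w 2 ⬝ᵥ J (w 3)
    by_cases h0 : a ^ 2 + b ^ 2 = 0
    · have ha : a = 0 := by nlinarith [sq_nonneg a, sq_nonneg b]
      exact ⟨1, 0, by norm_num, by rw [ha]; ring⟩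
    · have hpos : 0 < a ^ 2 + b ^ 2 := lt_of_le_of_ne (by positivity) (Ne.symm h0)
      have hsq := Real.sq_sqrt hpos.le
      have hne : Real.sqrt (a ^ 2 + b ^ 2) ≠ 0 := (Real.sqrt_pos.mpr hpos).ne'
      refine ⟨b / Real.sqrt (a ^ 2 + b ^ 2), -a / Real.sqrt (a ^ 2 + b ^ 2), ?_, ?_⟩
      · rw [div_pow, div_pow, hsq]; field_simp; ring
      · field_simp; ring
  let v : Fin 4 → ℝ := α • w 1 + β • w 2
  have hwv : ∀ k, w k ⬝ᵥ v = α * (if k = 1 then 1 else 0) + β * (if k = 2 then 1 else 0) := by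
    intro k
    simp only [v, dotProduct_add, dotProduct_smul, hw, smul_eq_mul]
  have hmem : (w 3, v) ∈ orthoPairs J := by
    refine ⟨by simp [hw], ?_, ?_, ?_⟩
    · show v ⬝ᵥ v = 1
      have : v ⬝ᵥ v = α * (w 1 ⬝ᵥ v) + β * (w 2 ⬝ᵥ v) := by
        simp only [v, add_dotProduct, smul_dotProduct, smul_eq_mul]
      rw [this, hwv, hwv]
      simp
      linear_combination hαβ
    · show v ⬝ᵥ w 3 = 0
      rw [dotProduct_comm, hwv]; simp
    · show v ⬝ᵥ J (w 3) = 0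
      simpa only [v, add_dotProduct, smul_dotProduct, smul_eq_mul] using hJ0
  have hlt := (hfS _ (subset_convexHull ℝ S ⟨_, hmem, rfl⟩)).trans hfD
  have hfpair : f (fun i j => s * (w 3 i * w 3 j) + (1 - s) * (v i * v j)) =
      s * quadForm X (w 3) + (1 - s) * quadForm X v := by
    rw [hfX _ (fun i j => by ring)]
    simp only [quadForm, Fin.sum_univ_four]
    ring
  have h3 : quadForm X (w 3) = x 3 := by
    rw [hXq]; simp [hw]
  have hv : x 1 ≤ quadForm X v := by
    rw [hXq, Fin.sum_univ_four]
    simp only [hwv]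
    have h12 : x 1 ≤ x 2 := hx (by decide)
    simp
    nlinarith [mul_nonneg (sub_nonneg.mpr h12) (sq_nonneg β), congrArg (x 1 * ·) hαβ]
  rw [hfD', Fin.sum_univ_four] at hlt
  rw [Fin.sum_univ_four] at htr'
  simp only [hfpair, h3] at hlt
  have h01 : x 0 ≤ x 1 := hx (by decide)
  have h12 : x 1 ≤ x 2 := hx (by decide)
  have h23 : x 2 ≤ x 3 := hx (by decide)
  have hp := hpair (w 2) (w 3) (by simp [hw]) (by simp [hw]) (by simp [hw])
  have e1 : (1 - s) * x 1 ≤ (1 - s) * quadForm X v :=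
    mul_le_mul_of_nonneg_left hv (sub_nonneg.mpr hs)
  have e2 := mul_nonneg (sub_nonneg.mpr h01) (hpos (w 0))
  have e3 := mul_nonneg (sub_nonneg.mpr h23) (hpos (w 2))
  have e4 := mul_nonneg (sub_nonneg.mpr (h12.trans h23)) (sub_nonneg.mpr hp)
  have e5 : quadForm D (w 0) = 1 - quadForm D (w 1) - quadForm D (w 2) - quadForm D (w 3) := by
    linarith
  rw [e5] at e2 hlt
  nlinarith
end ConvexHull

/-! ### Quaternions and Pauli matrices -/

section Quaternions

/-- The matrix `a · σ` for a vector `a` of `ℝ³`. -/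
noncomputable def pauliMat (a : Fin 3 → ℝ) : Matrix (Fin 2) (Fin 2) ℂ :=
  !![(a 2 : ℂ), a 0 - a 1 * Complex.I; a 0 + a 1 * Complex.I, -a 2]

/-- The quaternion `u 0 - i (u 1, u 2, u 3) · σ` as a complex `2 × 2` matrix. -/
noncomputable def quatMat (u : Fin 4 → ℝ) : Matrix (Fin 2) (Fin 2) ℂ :=
  !![u 0 - u 3 * Complex.I, -u 2 - u 1 * Complex.I; u 2 - u 1 * Complex.I, u 0 + u 3 * Complex.I]

/-- The imaginary part of the quaternion product `ū v`. -/
def imConjMul (u v : Fin 4 → ℝ) : Fin 3 → ℝ :=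
  ![u 0 * v 1 - u 1 * v 0 - (u 2 * v 3 - u 3 * v 2),
    u 0 * v 2 - u 2 * v 0 - (u 3 * v 1 - u 1 * v 3),
    u 0 * v 3 - u 3 * v 0 - (u 1 * v 2 - u 2 * v 1)]

/-- The imaginary part of the quaternion product `v ū`. -/
def imMulConj (u v : Fin 4 → ℝ) : Fin 3 → ℝ :=
  ![u 0 * v 1 - u 1 * v 0 + (u 2 * v 3 - u 3 * v 2),
    u 0 * v 2 - u 2 * v 0 + (u 3 * v 1 - u 1 * v 3),
    u 0 * v 3 - u 3 * v 0 + (u 1 * v 2 - u 2 * v 1)]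

/-- The quaternion product `u r` with the purely imaginary quaternion `r`. -/
def mulIm (r : Fin 3 → ℝ) (u : Fin 4 → ℝ) : Fin 4 → ℝ :=
  ![-(u 1 * r 0 + u 2 * r 1 + u 3 * r 2),
    u 0 * r 0 + (u 2 * r 2 - u 3 * r 1),
    u 0 * r 1 + (u 3 * r 0 - u 1 * r 2),
    u 0 * r 2 + (u 1 * r 1 - u 2 * r 0)]

theorem continuous_mulIm (r : Fin 3 → ℝ) : Continuous (mulIm r) := by
  unfold mulIm
  refine continuous_pi fun i => ?_
  fin_cases i <;> simp <;> fun_prop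

theorem imConjMul_dotProduct (r : Fin 3 → ℝ) (u v : Fin 4 → ℝ) :
    imConjMul u v ⬝ᵥ r = v ⬝ᵥ mulIm r u := by
  simp only [imConjMul, mulIm, dotProduct, Fin.sum_univ_three, Fin.sum_univ_four, Matrix.cons_val]
  ring

theorem imConjMul_dotProduct_self (u v : Fin 4 → ℝ) :
    imConjMul u v ⬝ᵥ imConjMul u v = (u ⬝ᵥ u) * (v ⬝ᵥ v) - (u ⬝ᵥ v) ^ 2 := by
  simp only [imConjMul, dotProduct, Fin.sum_univ_three, Fin.sum_univ_four, Matrix.cons_val]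
  ring

theorem imMulConj_dotProduct_self (u v : Fin 4 → ℝ) :
    imMulConj u v ⬝ᵥ imMulConj u v = (u ⬝ᵥ u) * (v ⬝ᵥ v) - (u ⬝ᵥ v) ^ 2 := by
  simp only [imMulConj, dotProduct, Fin.sum_univ_three, Fin.sum_univ_four, Matrix.cons_val]
  ring

theorem quatMat_mem_unitaryGroup {u : Fin 4 → ℝ} (hu : u ⬝ᵥ u = 1) :
    quatMat u ∈ Matrix.unitaryGroup (Fin 2) ℂ := by
  have h : (u 0 : ℂ) * u 0 + u 1 * u 1 + u 2 * u 2 + u 3 * u 3 = 1 := by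
    simp only [dotProduct, Fin.sum_univ_four] at hu
    exact_mod_cast hu
  rw [Matrix.mem_unitaryGroup_iff, Matrix.star_eq_conjTranspose]
  have hI := Complex.I_sq
  ext i j
  fin_cases i <;> fin_cases j <;>
    simp [quatMat, Matrix.mul_apply, Fin.sum_univ_two, Matrix.conjTranspose_apply]
  · linear_combination h - (u 3 * u 3 + u 1 * u 1 : ℂ) * hI
  · ring
  · ring
  · linear_combination h - (u 3 * u 3 + u 1 * u 1 : ℂ) * hI

/-- For orthogonal `u` and `v` the quaternion `ū v` is purely imaginary. -/
theorem quatMat_eq_mul_pauliMat {u v : Fin 4 → ℝ} (hu : u ⬝ᵥ u = 1) (huv : v ⬝ᵥ u = 0) :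
    quatMat v = -Complex.I • (quatMat u * pauliMat (imConjMul u v)) := by
  have h : (u 0 : ℂ) * u 0 + u 1 * u 1 + u 2 * u 2 + u 3 * u 3 = 1 := by
    simp only [dotProduct, Fin.sum_univ_four] at hu
    exact_mod_cast hu
  have h' : (v 0 : ℂ) * u 0 + v 1 * u 1 + v 2 * u 2 + v 3 * u 3 = 0 := by
    simp only [dotProduct, Fin.sum_univ_four] at huv
    exact_mod_cast huv
  have hI := Complex.I_sq
  have h1 : (-Complex.I • (quatMat u * pauliMat (imConjMul u v))) =
      ((u 0 : ℂ) * u 0 + u 1 * u 1 + u 2 * u 2 + u 3 * u 3) • quatMat v -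
      ((v 0 : ℂ) * u 0 + v 1 * u 1 + v 2 * u 2 + v 3 * u 3) • quatMat u := by
    ext i j
    fin_cases i <;> fin_cases j <;>
      simp [quatMat, pauliMat, imConjMul] <;>
      ring_nf <;>
      (simp only [hI, show Complex.I ^ 3 = -Complex.I by rw [pow_succ, hI]; ring]; ring)
  rw [h1, h, h', one_smul, zero_smul, sub_zero]

theorem pauliMat_isHermitian (a : Fin 3 → ℝ) : (pauliMat a).IsHermitian := by
  ext i j
  fin_cases i <;> fin_cases j <;> simp [pauliMat, Matrix.conjTranspose_apply] <;> ring

theorem pauliMat_det (a : Fin 3 → ℝ) : (pauliMat a).det = ((-(a ⬝ᵥ a) : ℝ) : ℂ) := by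
  have hI := Complex.I_sq
  rw [Matrix.det_fin_two]
  simp [pauliMat, dotProduct, Fin.sum_univ_three]
  linear_combination (a 1 * a 1 : ℂ) * hI

theorem swap_mem_unitaryGroup :
    (!![0, 1; 1, 0] : Matrix (Fin 2) (Fin 2) ℂ) ∈ Matrix.unitaryGroup (Fin 2) ℂ := by
  rw [Matrix.mem_unitaryGroup_iff, Matrix.star_eq_conjTranspose]
  ext i j
  fin_cases i <;> fin_cases j <;>
    simp [Matrix.mul_apply, Fin.sum_univ_two, Matrix.conjTranspose_apply]

/-- The eigenvalues of `a · σ` are `±|a|`. -/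
theorem exists_pauliMat_eq_conjDiag (a : Fin 3 → ℝ) {r : ℝ} (har : a ⬝ᵥ a = r ^ 2) :
    ∃ V ∈ Matrix.unitaryGroup (Fin 2) ℂ, pauliMat a = conjDiag V ![(r : ℂ), -r] := by
  obtain ⟨V, hV, e, he⟩ := isHermitian_exists_conjDiag (pauliMat_isHermitian a)
  have htr : e 0 + e 1 = 0 := by
    have h := congrArg Matrix.trace he
    rw [conjDiag_trace hV, Fin.sum_univ_two, Matrix.trace_fin_two] at h
    simp [pauliMat] at h
    exact_mod_cast h.symm
  have hdet : e 0 * e 1 = -r ^ 2 := by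
    have h := congrArg Matrix.det he
    have hVd : V.det * (Vᴴ).det = 1 := by
      rw [← Matrix.det_mul, unitary_mul_conjTranspose hV, Matrix.det_one]
    rw [pauliMat_det, conjDiag, Matrix.det_mul, Matrix.det_mul, mul_right_comm, hVd, one_mul,
      Matrix.det_diagonal, Fin.prod_univ_two, har] at h
    exact_mod_cast h.symm
  have h1 : e 1 = -e 0 := by linarith
  have h0 : e 0 ^ 2 = r ^ 2 := by rw [h1] at hdet; linarith
  rcases sq_eq_sq_iff_eq_or_eq_neg.mp h0 with h | h
  · refine ⟨V, hV, he.trans ?_⟩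
    congr 1; ext i; fin_cases i <;> simp [h1, h]
  · refine ⟨V * !![0, 1; 1, 0], mul_mem hV swap_mem_unitaryGroup, he.trans ?_⟩
    have hd : Matrix.diagonal ![(r : ℂ), -r] = !![(r : ℂ), 0; 0, -r] := by
      ext i j
      fin_cases i <;> fin_cases j <;> simp
    rw [← conj_conjDiag, conjDiag]
    congr 2
    rw [conjDiag, hd]
    ext i j
    fin_cases i <;> fin_cases j <;>
      simp [h1, h, Matrix.mul_apply, Fin.sum_univ_two, Matrix.conjTranspose_apply]

theorem half_one_add_pauliMat_eq {a : Fin 3 → ℝ} {r : ℝ} {V : Matrix (Fin 2) (Fin 2) ℂ}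
    (hV : V ∈ Matrix.unitaryGroup (Fin 2) ℂ) (h : pauliMat a = conjDiag V ![(r : ℂ), -r]) :
    (1 / 2 : ℂ) • (1 + pauliMat a) =
      conjDiag V fun i => ((![(1 + r) / 2, (1 - r) / 2] i : ℝ) : ℂ) := by
  rw [h, ← conjDiag_one hV, ← conjDiag_add, ← conjDiag_smul]
  congr 1; ext i; fin_cases i <;> simp [Matrix.vecHead, Matrix.vecTail] <;> ring

end Quaternions

/-! ### Unital channels as quadratic forms on quaternions -/

section BlochMatrix

variable {Φ : Matrix (Fin 2) (Fin 2) ℂ →ₗ[ℂ] Matrix (Fin 2) (Fin 2) ℂ}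

theorem IsChannel.posSemidef (hΦ : IsChannel Φ) {M : Matrix (Fin 2) (Fin 2) ℂ}
    (hM : M.PosSemidef) : (Φ M).PosSemidef :=
  (hΦ.completelyPositive 1 (M.submatrix Prod.snd Prod.snd) (hM.submatrix _)).submatrix
    fun a => ((0 : Fin 1), a)

theorem IsChannel.isState (hΦ : IsChannel Φ) {M : Matrix (Fin 2) (Fin 2) ℂ}
    (hM : IsState M) : IsState (Φ M) :=
  ⟨hΦ.posSemidef hM.1, (hΦ.tracePreserving M).trans hM.2⟩

/-- Positivity of the Choi matrix of a channel. -/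
theorem IsChannel.choi_posSemidef (hΦ : IsChannel Φ) :
    (Matrix.of fun x y : Fin 2 × Fin 2 => Φ (Matrix.single x.1 y.1 1) x.2 y.2).PosSemidef := by
  have h := hΦ.completelyPositive 2 _ (Matrix.posSemidef_vecMulVec_self_star
    fun x : Fin 2 × Fin 2 => if x.1 = x.2 then (1 : ℂ) else 0)
  convert h using 1
  ext ⟨a, c⟩ ⟨b, d⟩
  simp only [idTensor, LinearMap.coe_mk, AddHom.coe_mk, Matrix.of_apply]
  refine congrFun (congrFun (congrArg Φ ?_) c) d
  ext i j
  simp only [Matrix.vecMulVec_apply, Matrix.of_apply, Matrix.single_apply, Pi.star_apply]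
  by_cases h1 : a = i <;> by_cases h2 : b = j <;> simp [h1, h2]

theorem IsChannel.isHermitian_map_pauliMat (hΦ : IsChannel Φ) (a : Fin 3 → ℝ) :
    (Φ (pauliMat a)).IsHermitian := by
  -- `a · σ` is a difference of positive matrices.
  set c := Real.sqrt (a ⬝ᵥ a) with hc
  have hc0 : 0 ≤ c := Real.sqrt_nonneg _
  obtain ⟨V, hV, h⟩ := exists_pauliMat_eq_conjDiag a
    (Real.sq_sqrt (Finset.sum_nonneg fun i _ => mul_self_nonneg (a i))).symm
  have h1 : pauliMat a = conjDiag V (fun i => ((![c, 0] i : ℝ) : ℂ)) -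
      conjDiag V (fun i => ((![0, c] i : ℝ) : ℂ)) := by
    rw [eq_sub_iff_add_eq, h, ← conjDiag_add]
    congr 1; ext i; fin_cases i <;> simp [hc, dotProduct]
  rw [h1, map_sub]
  refine (hΦ.posSemidef (conjDiag_posSemidef V fun i => ?_)).1.sub
    (hΦ.posSemidef (conjDiag_posSemidef V fun i => ?_)).1 <;> fin_cases i <;> simp [hc0]

theorem eq_pauliMat_of_isHermitian {M : Matrix (Fin 2) (Fin 2) ℂ} (hM : M.IsHermitian)
    (htr : M.trace = 0) : M = pauliMat ![(M 0 1).re, -(M 0 1).im, (M 0 0).re] := by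
  have h00 := hM.apply 0 0
  have h10 := hM.apply 1 0
  rw [Matrix.trace_fin_two] at htr
  have h00' : ((M 0 0).re : ℂ) = M 0 0 := Complex.conj_eq_iff_re.mp h00
  have h01 : ((M 0 1).re : ℂ) + (M 0 1).im * Complex.I = M 0 1 := Complex.re_add_im _
  ext i j
  fin_cases i <;> fin_cases j
  · simp [pauliMat, h00']
  · simp [pauliMat, h01]
  · simp only [pauliMat, Fin.mk_one, Fin.zero_eta, Matrix.of_apply, Matrix.cons_val]
    rw [← h10]
    apply Complex.ext <;> simp
  · simp only [pauliMat, Fin.mk_one, Matrix.of_apply, Matrix.cons_val]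
    rw [h00']
    linear_combination htr

/-- The matrix of a unital channel on the Bloch ball: its columns are the vectors `b` with
`Φ (e j · σ) = b · σ`, read off from the entries `(0, 1)` and `(0, 0)` of a Hermitian traceless
matrix. -/
noncomputable def blochMatrix (Φ : Matrix (Fin 2) (Fin 2) ℂ →ₗ[ℂ] Matrix (Fin 2) (Fin 2) ℂ) :
    Matrix (Fin 3) (Fin 3) ℝ :=
  Matrix.of fun i j => (![(Φ (pauliMat (Pi.single j 1)) 0 1).re,
    -(Φ (pauliMat (Pi.single j 1)) 0 1).im, (Φ (pauliMat (Pi.single j 1)) 0 0).re] : Fin 3 → ℝ) i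

theorem IsChannel.map_pauliMat_single (hΦ : IsChannel Φ) (j : Fin 3) :
    Φ (pauliMat (Pi.single j 1)) = pauliMat fun i => blochMatrix Φ i j := by
  refine eq_pauliMat_of_isHermitian (hΦ.isHermitian_map_pauliMat _) ?_
  rw [hΦ.tracePreserving, Matrix.trace_fin_two]
  simp [pauliMat]

theorem matrix_eq_pauli_combination (M : Matrix (Fin 2) (Fin 2) ℂ) :
    M = ((M 0 0 + M 1 1) / 2) • (1 : Matrix (Fin 2) (Fin 2) ℂ) +
      ((M 0 1 + M 1 0) / 2) • pauliMat (Pi.single 0 1) +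
      (Complex.I * (M 0 1 - M 1 0) / 2) • pauliMat (Pi.single 1 1) +
      ((M 0 0 - M 1 1) / 2) • pauliMat (Pi.single 2 1) := by
  have hI := Complex.I_sq
  ext i j
  fin_cases i <;> fin_cases j <;> simp [pauliMat]
  · ring
  · linear_combination ((M 0 1 - M 1 0) / 2) * hI
  · linear_combination (-(M 0 1 - M 1 0) / 2) * hI
  · ring

theorem IsChannel.apply_eq (hΦ : IsChannel Φ) (hu : IsUnital Φ) (M : Matrix (Fin 2) (Fin 2) ℂ) :
    Φ M = ((M 0 0 + M 1 1) / 2) • (1 : Matrix (Fin 2) (Fin 2) ℂ) +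
      ((M 0 1 + M 1 0) / 2) • pauliMat (fun i => blochMatrix Φ i 0) +
      (Complex.I * (M 0 1 - M 1 0) / 2) • pauliMat (fun i => blochMatrix Φ i 1) +
      ((M 0 0 - M 1 1) / 2) • pauliMat (fun i => blochMatrix Φ i 2) := by
  have hu' : Φ 1 = 1 := hu
  conv_lhs => rw [matrix_eq_pauli_combination M]
  simp only [map_add, map_smul, hΦ.map_pauliMat_single, hu']

theorem IsChannel.map_pauliMat (hΦ : IsChannel Φ) (hu : IsUnital Φ) (a : Fin 3 → ℝ) :
    Φ (pauliMat a) = pauliMat (blochMatrix Φ *ᵥ a) := by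
  have hI := Complex.I_sq
  rw [hΦ.apply_eq hu]
  ext i j
  fin_cases i <;> fin_cases j <;>
    simp [pauliMat, Matrix.mulVec, dotProduct, Fin.sum_univ_three] <;> ring_nf <;>
    simp only [hI, show Complex.I ^ 3 = -Complex.I by rw [pow_succ, hI]; ring] <;> ring

/-- The coefficients `D` in `Φ M = ∑ D j k • Q j * M * (Q k)ᴴ`, where `Q 0, …, Q 3` are the
quaternion units `1, -iσ₁, -iσ₂, -iσ₃`, in terms of the matrix `T` of `Φ` on the Bloch ball. -/
noncomputable def quatCoeff (T : Matrix (Fin 3) (Fin 3) ℝ) : Fin 4 → Fin 4 → ℝ :=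
  ![![(1 + T 0 0 + T 1 1 + T 2 2) / 4, (T 2 1 - T 1 2) / 4, (T 0 2 - T 2 0) / 4,
      (T 1 0 - T 0 1) / 4],
    ![(T 2 1 - T 1 2) / 4, (1 + T 0 0 - T 1 1 - T 2 2) / 4, (T 0 1 + T 1 0) / 4,
      (T 0 2 + T 2 0) / 4],
    ![(T 0 2 - T 2 0) / 4, (T 0 1 + T 1 0) / 4, (1 - T 0 0 + T 1 1 - T 2 2) / 4,
      (T 1 2 + T 2 1) / 4],
    ![(T 1 0 - T 0 1) / 4, (T 0 2 + T 2 0) / 4, (T 1 2 + T 2 1) / 4,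
      (1 - T 0 0 - T 1 1 + T 2 2) / 4]]

theorem quatCoeff_symm (T : Matrix (Fin 3) (Fin 3) ℝ) (i j : Fin 4) :
    quatCoeff T i j = quatCoeff T j i := by
  fin_cases i <;> fin_cases j <;> rfl

theorem quatCoeff_trace (T : Matrix (Fin 3) (Fin 3) ℝ) : ∑ i, quatCoeff T i i = 1 := by
  simp [quatCoeff, Fin.sum_univ_four]
  ring

/-- The map `M ↦ ∑ D j k • Q j * M * (Q k)ᴴ`. -/
noncomputable def quatSum (D : Fin 4 → Fin 4 → ℝ) (M : Matrix (Fin 2) (Fin 2) ℂ) :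
    Matrix (Fin 2) (Fin 2) ℂ :=
  ∑ j, ∑ k, (D j k : ℂ) • (quatMat (Pi.single j 1) * M * (quatMat (Pi.single k 1))ᴴ)

theorem mul_mul_conjTranspose_fin_two (A M B : Matrix (Fin 2) (Fin 2) ℂ) (i j : Fin 2) :
    (A * M * Bᴴ) i j = A i 0 * M 0 0 * star (B j 0) + A i 0 * M 0 1 * star (B j 1) +
      A i 1 * M 1 0 * star (B j 0) + A i 1 * M 1 1 * star (B j 1) := by
  simp only [Matrix.mul_apply, Fin.sum_univ_two, Matrix.conjTranspose_apply]
  ring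

theorem IsChannel.eq_quatSum (hΦ : IsChannel Φ) (hu : IsUnital Φ)
    (M : Matrix (Fin 2) (Fin 2) ℂ) : Φ M = quatSum (quatCoeff (blochMatrix Φ)) M := by
  have hI := Complex.I_sq
  rw [hΦ.apply_eq hu]
  generalize blochMatrix Φ = T
  ext i j
  fin_cases i <;> fin_cases j <;>
    simp only [quatSum, Fin.sum_univ_four, Matrix.add_apply, Matrix.smul_apply,
      mul_mul_conjTranspose_fin_two] <;>
    simp [quatCoeff, pauliMat, quatMat] <;> ring_nf <;>
    (try simp only [hI]) <;> ring

theorem quatSum_rankOne (u : Fin 4 → ℝ) (M : Matrix (Fin 2) (Fin 2) ℂ) :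
    quatSum (fun i j => u i * u j) M = quatMat u * M * (quatMat u)ᴴ := by
  have h : quatMat u = ∑ j, (u j : ℂ) • quatMat (Pi.single j 1) := by
    ext i j
    fin_cases i <;> fin_cases j <;> simp [quatMat, Fin.sum_univ_four, Pi.single_apply] <;> ring
  rw [h, quatSum, Matrix.conjTranspose_sum]
  simp only [Matrix.conjTranspose_smul, Finset.sum_mul, Finset.mul_sum, smul_mul_assoc,
    mul_smul_comm, Finset.smul_sum, smul_smul]
  rw [Finset.sum_comm]
  refine Finset.sum_congr rfl fun i _ => Finset.sum_congr rfl fun j _ => ?_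
  simp [mul_comm]

theorem quatSum_add (D E : Fin 4 → Fin 4 → ℝ) (M : Matrix (Fin 2) (Fin 2) ℂ) :
    quatSum (D + E) M = quatSum D M + quatSum E M := by
  simp [quatSum, add_smul, Finset.sum_add_distrib]

theorem quatSum_smul (c : ℝ) (D : Fin 4 → Fin 4 → ℝ) (M : Matrix (Fin 2) (Fin 2) ℂ) :
    quatSum (c • D) M = (c : ℂ) • quatSum D M := by
  simp only [quatSum, Finset.smul_sum, smul_smul, Pi.smul_apply, smul_eq_mul, Complex.ofReal_mul]

theorem quatSum_sum {ι : Type*} (s : Finset ι) (D : ι → Fin 4 → Fin 4 → ℝ)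
    (M : Matrix (Fin 2) (Fin 2) ℂ) : quatSum (∑ i ∈ s, D i) M = ∑ i ∈ s, quatSum (D i) M := by
  classical
  induction s using Finset.induction_on with
  | empty => simp [quatSum]
  | insert i s hi ih => rw [Finset.sum_insert hi, Finset.sum_insert hi, quatSum_add, ih]

/-- Complete positivity is the positivity of the coefficient form: up to the factor 4, it is
the form of the Choi matrix on quaternions. -/
theorem IsChannel.quadForm_quatCoeff_nonneg (hΦ : IsChannel Φ) (hu : IsUnital Φ)
    (u : Fin 4 → ℝ) : 0 ≤ quadForm (quatCoeff (blochMatrix Φ)) u := by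
  have h := hΦ.choi_posSemidef.re_dotProduct_nonneg fun x => quatMat u x.2 x.1
  have h1 : (star (fun x : Fin 2 × Fin 2 => quatMat u x.2 x.1) ⬝ᵥ
      ((Matrix.of fun x y : Fin 2 × Fin 2 => Φ (Matrix.single x.1 y.1 1) x.2 y.2) *ᵥ
        fun x => quatMat u x.2 x.1)) =
      ((4 * quadForm (quatCoeff (blochMatrix Φ)) u : ℝ) : ℂ) := by
    have hI := Complex.I_sq
    simp only [dotProduct, Matrix.mulVec, Fintype.sum_prod_type, Fin.sum_univ_two, Matrix.of_apply,
      hΦ.apply_eq hu]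
    generalize blochMatrix Φ = T
    simp [quadForm, quatCoeff, quatMat, pauliMat, Fin.sum_univ_four]
    ring_nf
    simp only [hI, show Complex.I ^ 4 = 1 by rw [show 4 = 2 * 2 by rfl, pow_mul, hI]; ring]
    ring
  rw [h1] at h
  have h2 : (0 : ℝ) ≤ 4 * quadForm (quatCoeff (blochMatrix Φ)) u := by simpa using h
  linarith

/-- The value of the coefficient form on an orthonormal pair. The reason: the rotations of `u` and
`v` on `ℝ³` sum to `2 b aᵀ`, with `a` and `b` the imaginary parts of `ū v` and `v ū`. -/
theorem quadForm_quatCoeff_add (T : Matrix (Fin 3) (Fin 3) ℝ) {u v : Fin 4 → ℝ}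
    (hu : u ⬝ᵥ u = 1) (hv : v ⬝ᵥ v = 1) (huv : u ⬝ᵥ v = 0) :
    quadForm (quatCoeff T) u + quadForm (quatCoeff T) v =
      (1 + imMulConj u v ⬝ᵥ (T *ᵥ imConjMul u v)) / 2 := by
  -- A polynomial identity, homogenized so that it holds without the orthonormality relations.
  have key : quadForm (quatCoeff T) u * (v ⬝ᵥ v) + quadForm (quatCoeff T) v * (u ⬝ᵥ u) =
      ((u ⬝ᵥ u) * (v ⬝ᵥ v) + imMulConj u v ⬝ᵥ (T *ᵥ imConjMul u v)) / 2 +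
      (u ⬝ᵥ v) * (2 * (∑ i, ∑ j, quatCoeff T i j * (u i * v j)) - (u ⬝ᵥ v) / 2) := by
    simp [quadForm, quatCoeff, imMulConj, imConjMul, dotProduct, Matrix.mulVec,
      Fin.sum_univ_four, Fin.sum_univ_three]
    ring
  rw [hu, hv, huv] at key
  linarith

end BlochMatrix

/-! ### The maximal output norm -/

section MaximalNorm

variable {n : Type*} [Fintype n] [DecidableEq n]

theorem pNorm_le_one_of_isState {ω : Matrix n n ℂ} (hω : IsState ω) {p : ℝ} (hp : 1 ≤ p) :
    pNorm p ω ≤ 1 := by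
  obtain ⟨hpos, htr⟩ := hω
  obtain ⟨V, hV, a, ha, rfl⟩ := posSemidef_exists_conjDiag hpos
  rw [conjDiag_trace hV, ← Complex.ofReal_sum] at htr
  have hsum : ∑ i, a i = 1 := by exact_mod_cast htr
  rw [pNorm_conjDiag hV ha]
  refine Real.rpow_le_one (Finset.sum_nonneg fun i _ => Real.rpow_nonneg (ha i) _) ?_
    (by positivity)
  rw [← hsum]
  refine Finset.sum_le_sum fun i _ => ?_
  have h1 : a i ≤ 1 := by
    rw [← hsum]
    exact Finset.single_le_sum (fun j _ => ha j) (Finset.mem_univ i)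
  calc a i ^ p ≤ a i ^ (1 : ℝ) := Real.rpow_le_rpow_of_exponent_ge' (ha i) h1 zero_le_one hp
    _ = a i := Real.rpow_one _

variable {Φ : Matrix (Fin 2) (Fin 2) ℂ →ₗ[ℂ] Matrix (Fin 2) (Fin 2) ℂ}

theorem IsChannel.pNorm_le_maxPNorm (hΦ : IsChannel Φ) {ω : Matrix (Fin 2) (Fin 2) ℂ}
    (hω : IsState ω) {p : ℝ} (hp : 1 ≤ p) : pNorm p (Φ ω) ≤ maxPNorm p Φ :=
  le_csSup ⟨1, by rintro _ ⟨ω, hω, rfl⟩; exact pNorm_le_one_of_isState (hΦ.isState hω) hp⟩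
    ⟨ω, hω, rfl⟩

theorem isState_half_one_add_pauliMat {a : Fin 3 → ℝ} (ha : a ⬝ᵥ a = 1) :
    IsState ((1 / 2 : ℂ) • (1 + pauliMat a)) := by
  obtain ⟨V, hV, h⟩ := exists_pauliMat_eq_conjDiag a (r := 1) (by rw [ha, one_pow])
  rw [half_one_add_pauliMat_eq hV h]
  refine ⟨conjDiag_posSemidef V fun i => ?_, ?_⟩
  · fin_cases i <;> simp
  · rw [conjDiag_trace hV]; simp

/-- The largest stretching factor `t` of the Bloch ball under a unital channel. The state whose
Bloch vector is stretched most has image with eigenvalues `(1 ± t) / 2`, hence `m_p(t) ≤ ν_p(Φ)`. -/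
theorem IsChannel.exists_bloch_norm (hΦ : IsChannel Φ) (hu : IsUnital Φ) :
    ∃ t : ℝ, 0 ≤ t ∧ t ≤ 1 ∧ (∀ p : ℝ, 1 ≤ p → mFun p t ≤ maxPNorm p Φ) ∧
      ∀ a b : Fin 3 → ℝ, a ⬝ᵥ a = 1 → b ⬝ᵥ b = 1 → b ⬝ᵥ (blochMatrix Φ *ᵥ a) ≤ t := by
  set T := blochMatrix Φ with hT
  have hcont : Continuous fun a : Fin 3 → ℝ => (T *ᵥ a) ⬝ᵥ (T *ᵥ a) :=
    (continuous_const.matrix_mulVec continuous_id).dotProduct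
      (continuous_const.matrix_mulVec continuous_id)
  have hclosed : IsClosed {a : Fin 3 → ℝ | a ⬝ᵥ a = 1} :=
    isClosed_eq (continuous_id.dotProduct continuous_id) continuous_const
  have hcompact : IsCompact {a : Fin 3 → ℝ | a ⬝ᵥ a = 1} :=
    isCompact_Icc.of_isClosed_subset hclosed fun a ha => mem_Icc_of_dotProduct_self_eq_one ha
  -- A pure state whose Bloch vector is stretched most.
  obtain ⟨a, ha, hmax⟩ := hcompact.exists_isMaxOn
    ⟨Pi.single 0 1, by simp [dotProduct, Fin.sum_univ_three]⟩ hcont.continuousOn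
  have ha : a ⬝ᵥ a = 1 := ha
  set t := Real.sqrt ((T *ᵥ a) ⬝ᵥ (T *ᵥ a)) with ht
  have hsq : (T *ᵥ a) ⬝ᵥ (T *ᵥ a) = t ^ 2 :=
    (Real.sq_sqrt (Finset.sum_nonneg fun i _ => mul_self_nonneg _)).symm
  have ht0 : 0 ≤ t := Real.sqrt_nonneg _
  obtain ⟨V, hV, hVT⟩ := exists_pauliMat_eq_conjDiag (T *ᵥ a) hsq
  have hmap : Φ ((1 / 2 : ℂ) • (1 + pauliMat a)) =
      conjDiag V fun i => ((![(1 + t) / 2, (1 - t) / 2] i : ℝ) : ℂ) := by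
    have hu' : Φ 1 = 1 := hu
    rw [map_smul, map_add, hu', hΦ.map_pauliMat hu, ← hT, half_one_add_pauliMat_eq hV hVT]
  have hstate := isState_half_one_add_pauliMat ha
  have ht1 : t ≤ 1 := by
    have h1 := (hΦ.posSemidef hstate.1).det_nonneg
    have hVd : V.det * (Vᴴ).det = 1 := by
      rw [← Matrix.det_mul, unitary_mul_conjTranspose hV, Matrix.det_one]
    rw [hmap, conjDiag, Matrix.det_mul, Matrix.det_mul, mul_right_comm, hVd, one_mul,
      Matrix.det_diagonal, Fin.prod_univ_two, ← Complex.ofReal_mul, Complex.zero_le_real] at h1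
    simp only [Matrix.cons_val] at h1
    nlinarith
  refine ⟨t, ht0, ht1, fun p hp => ?_, fun x y hx hy => ?_⟩
  · have h1 := hΦ.pNorm_le_maxPNorm hstate hp
    rw [hmap, pNorm_conjDiag hV (fun i => by fin_cases i <;> simp <;> linarith),
      Fin.sum_univ_two] at h1
    exact h1
  · have h1 : (T *ᵥ x) ⬝ᵥ (T *ᵥ x) ≤ t ^ 2 := by rw [← hsq]; exact hmax hx
    have h2 : (y ⬝ᵥ (T *ᵥ x)) ^ 2 ≤ (y ⬝ᵥ y) * ((T *ᵥ x) ⬝ᵥ (T *ᵥ x)) := by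
      simpa only [dotProduct, sq] using Finset.sum_mul_sq_le_sq_mul_sq Finset.univ y (T *ᵥ x)
    rw [hy, one_mul] at h2
    exact (abs_le_of_sq_le_sq' (h2.trans h1) ht0).2

end MaximalNorm

/-! ### Decomposition into phase-damping channels -/

section Decomposition

variable {Φ : Matrix (Fin 2) (Fin 2) ℂ →ₗ[ℂ] Matrix (Fin 2) (Fin 2) ℂ}

theorem phaseDamping_eq (t : ℝ) (M : Matrix (Fin 2) (Fin 2) ℂ) :
    phaseDamping t M = (((1 + t) / 2 : ℝ) : ℂ) • M +
      (((1 - t) / 2 : ℝ) : ℂ) • (pauliThree * M * pauliThree) := by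
  ext a b
  simp only [Matrix.add_apply, Matrix.smul_apply, Matrix.mul_apply, Fin.sum_univ_two]
  fin_cases a <;> fin_cases b <;> simp [phaseDamping, pauliThree] <;> ring

theorem conjDiag_one_neg_one (V : Matrix (Fin 2) (Fin 2) ℂ) :
    conjDiag V ![((1 : ℝ) : ℂ), -((1 : ℝ) : ℂ)] = V * pauliThree * Vᴴ := by
  have h : Matrix.diagonal ![((1 : ℝ) : ℂ), -((1 : ℝ) : ℂ)] = pauliThree := by
    ext i j
    fin_cases i <;> fin_cases j <;> simp [pauliThree]
  rw [conjDiag, h]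

/-- A unital channel is a mixture of unitarily rotated phase-damping channels, whose parameter `t`
satisfies `m_p(t) ≤ ν_p(Φ)` and whose axes are orthogonal to a prescribed vector `r`. -/
theorem IsChannel.exists_phaseDamping_mixture (hΦ : IsChannel Φ) (hu : IsUnital Φ)
    (r : Fin 3 → ℝ) :
    ∃ t : ℝ, |t| ≤ 1 ∧ (∀ p : ℝ, 1 ≤ p → mFun p t ≤ maxPNorm p Φ) ∧
      ∃ (N : ℕ) (c : Fin N → ℝ) (A V : Fin N → Matrix (Fin 2) (Fin 2) ℂ) (a : Fin N → Fin 3 → ℝ),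
        (∀ i, 0 < c i) ∧ ∑ i, c i = 1 ∧ (∀ i, A i ∈ Matrix.unitaryGroup (Fin 2) ℂ) ∧
        (∀ i, V i ∈ Matrix.unitaryGroup (Fin 2) ℂ) ∧
        (∀ i, pauliMat (a i) = V i * pauliThree * (V i)ᴴ) ∧ (∀ i, a i ⬝ᵥ r = 0) ∧
        ∀ M, Φ M = ∑ i, (c i : ℂ) • (A i * phaseDamping t ((V i)ᴴ * M * V i) * (A i)ᴴ) := by
  obtain ⟨t, ht0, ht1, hν, ht⟩ := hΦ.exists_bloch_norm hu
  refine ⟨t, abs_le.mpr ⟨by linarith, ht1⟩, hν, ?_⟩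
  -- With `J u = u r`, a pair `u`, `v` gives the axis `a = Im ū v`, and `v ⊥ u r` means `a ⊥ r`.
  have hmem := mem_convexHull_orthoPairs (continuous_mulIm r) (s := (1 + t) / 2)
    (quatCoeff_symm (blochMatrix Φ)) (hΦ.quadForm_quatCoeff_nonneg hu) (quatCoeff_trace _)
    (by linarith) (fun u v hu' hv huv => by
      rw [quadForm_quatCoeff_add _ hu' hv huv]
      have := ht (imConjMul u v) (imMulConj u v)
        (by rw [imConjMul_dotProduct_self, hu', hv, huv]; norm_num)
        (by rw [imMulConj_dotProduct_self, hu', hv, huv]; norm_num)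
      linarith)
  obtain ⟨ι, _, z, c, hz, -, hc, hc1, hsum⟩ := eq_pos_convex_span_of_mem_convexHull hmem
  choose q hq hqz using fun i => hz ⟨i, rfl⟩
  have haxis : ∀ i, ∃ V ∈ Matrix.unitaryGroup (Fin 2) ℂ,
      pauliMat (imConjMul (q i).1 (q i).2) = V * pauliThree * Vᴴ := by
    intro i
    obtain ⟨h1, h2, h3, -⟩ := hq i
    obtain ⟨V, hV, h⟩ := exists_pauliMat_eq_conjDiag (imConjMul (q i).1 (q i).2) (r := 1)
      (by rw [imConjMul_dotProduct_self, h1, h2, dotProduct_comm, h3]; norm_num)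
    exact ⟨V, hV, h.trans (conjDiag_one_neg_one V)⟩
  choose V hV hVa using haxis
  have hpair : ∀ i M, quatSum (z i) M = (quatMat (q i).1 * V i) *
      phaseDamping t ((V i)ᴴ * M * V i) * (quatMat (q i).1 * V i)ᴴ := by
    intro i M
    obtain ⟨h1, h2, h3, -⟩ := hq i
    have hVV := unitary_mul_conjTranspose (hV i)
    have e1 : z i = ((1 + t) / 2) • (fun j k => (q i).1 j * (q i).1 k) +
        ((1 - t) / 2) • (fun j k => (q i).2 j * (q i).2 k) := by
      rw [← hqz i]
      ext j k
      simp only [Pi.add_apply, Pi.smul_apply, smul_eq_mul]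
      ring
    have hs3 : pauliThreeᴴ = pauliThree := by
      ext j k
      fin_cases j <;> fin_cases k <;> simp [pauliThree, Matrix.conjTranspose_apply]
    have e2 : quatMat (q i).2 * M * (quatMat (q i).2)ᴴ = quatMat (q i).1 * V i *
        (pauliThree * ((V i)ᴴ * M * V i) * pauliThree) * (quatMat (q i).1 * V i)ᴴ := by
      rw [quatMat_eq_mul_pauliMat h1 h3, hVa]
      simp only [Matrix.conjTranspose_smul, Matrix.conjTranspose_mul,
        Matrix.conjTranspose_conjTranspose, hs3, smul_mul_assoc, mul_smul_comm, smul_smul]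
      have : star (-Complex.I) * -Complex.I = 1 := by simp
      rw [this, one_smul]
      simp only [mul_assoc]
    have e3 : quatMat (q i).1 * M * (quatMat (q i).1)ᴴ = quatMat (q i).1 * V i *
        ((V i)ᴴ * M * V i) * (quatMat (q i).1 * V i)ᴴ := by
      have : quatMat (q i).1 * V i * ((V i)ᴴ * M * V i) * (quatMat (q i).1 * V i)ᴴ =
          quatMat (q i).1 * (V i * (V i)ᴴ) * M * (V i * (V i)ᴴ) * (quatMat (q i).1)ᴴ := by
        simp only [Matrix.conjTranspose_mul, mul_assoc]
      rw [this, hVV, mul_one, mul_one]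
    rw [e1, quatSum_add, quatSum_smul, quatSum_smul, quatSum_rankOne, quatSum_rankOne, e2, e3,
      phaseDamping_eq, mul_add, add_mul, mul_smul_comm, mul_smul_comm, smul_mul_assoc,
      smul_mul_assoc]
  let e := (Fintype.equivFin ι).symm
  refine ⟨Fintype.card ι, c ∘ e, fun i => quatMat (q (e i)).1 * V (e i), V ∘ e,
    fun i => imConjMul (q (e i)).1 (q (e i)).2, fun i => hc _, ?_,
    fun i => mul_mem (quatMat_mem_unitaryGroup (hq _).1) (hV _), fun i => hV _, fun i => hVa _,
    fun i => ?_, fun M => ?_⟩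
  · rw [← hc1]; exact Equiv.sum_comp e c
  · rw [imConjMul_dotProduct]; exact (hq _).2.2.2
  · rw [hΦ.eq_quatSum hu, ← hsum, quatSum_sum]
    simp only [quatSum_smul, hpair]
    exact (Equiv.sum_comp e fun i => (c i : ℂ) • ((quatMat (q i).1 * V i) *
      phaseDamping t ((V i)ᴴ * M * V i) * (quatMat (q i).1 * V i)ᴴ)).symm

theorem traceFirst_isHermitian {K : ℕ} {ρ : Matrix (Fin K × Fin 2) (Fin K × Fin 2) ℂ}
    (hρ : ρ.IsHermitian) : (traceFirst ρ).IsHermitian := by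
  ext a b
  simp only [traceFirst, Matrix.conjTranspose_apply, Matrix.of_apply, star_sum]
  exact Finset.sum_congr rfl fun k _ => hρ.apply _ _

/-- The trace pairing of `a · σ` with a Hermitian matrix is the inner product of Bloch vectors. -/
theorem trace_pauliMat_mul (a : Fin 3 → ℝ) {R : Matrix (Fin 2) (Fin 2) ℂ} (hR : R.IsHermitian) :
    (pauliMat a * R).trace =
      ((a ⬝ᵥ ![2 * (R 0 1).re, -(2 * (R 0 1).im), (R 0 0).re - (R 1 1).re] : ℝ) : ℂ) := by
  have h0 : (R 0 0).im = 0 := Complex.conj_eq_iff_im.mp (hR.apply 0 0)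
  have h1 : (R 1 1).im = 0 := Complex.conj_eq_iff_im.mp (hR.apply 1 1)
  have h2 : R 1 0 = star (R 0 1) := (hR.apply 1 0).symm
  rw [Matrix.trace_fin_two, Matrix.mul_apply, Matrix.mul_apply, Fin.sum_univ_two,
    Fin.sum_univ_two, h2]
  apply Complex.ext <;>
    simp [pauliMat, dotProduct, Fin.sum_univ_three, h0, h1] <;> ring

/-- Conjugation by matrices `1 ⊗ A` and `1 ⊗ B` acts on each `2 × 2` block. -/
theorem one_kronecker_mul_mul_apply {K : ℕ} (A B : Matrix (Fin 2) (Fin 2) ℂ)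
    (ρ : Matrix (Fin K × Fin 2) (Fin K × Fin 2) ℂ) (x y : Fin K × Fin 2) :
    (((1 : Matrix (Fin K) (Fin K) ℂ) ⊗ₖ A) * ρ * ((1 : Matrix (Fin K) (Fin K) ℂ) ⊗ₖ B)) x y =
      (A * (Matrix.of fun a b => ρ (x.1, a) (y.1, b)) * B) x.2 y.2 := by
  simp only [Matrix.mul_apply, Matrix.kroneckerMap_apply, Fintype.sum_prod_type, Matrix.one_apply,
    Matrix.of_apply, Fin.sum_univ_two]
  simp [Finset.sum_add_distrib, ite_mul, mul_ite]

theorem one_kronecker_mem_unitaryGroup (K : ℕ) {A : Matrix (Fin 2) (Fin 2) ℂ}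
    (hA : A ∈ Matrix.unitaryGroup (Fin 2) ℂ) :
    (1 : Matrix (Fin K) (Fin K) ℂ) ⊗ₖ A ∈ Matrix.unitaryGroup (Fin K × Fin 2) ℂ :=
  Matrix.kronecker_mem_unitary (one_mem _) hA

end Decomposition

theorem theorem3 (K : ℕ)
    (Φ : Matrix (Fin 2) (Fin 2) ℂ →ₗ[ℂ] Matrix (Fin 2) (Fin 2) ℂ)
    (hΦ : IsChannel Φ) (hΦ_unital : IsUnital Φ)
    (ρ : Matrix (Fin K × Fin 2) (Fin K × Fin 2) ℂ) (hρ : IsState ρ) :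
    ∃ (N : ℕ) (c : Fin N → ℝ) (U : Fin N → Matrix (Fin 2) (Fin 2) ℂ),
      1 ≤ N ∧ (∀ i, 0 < c i) ∧ ∑ i, c i = 1 ∧
      (∀ i, U i ∈ Matrix.unitaryGroup (Fin 2) ℂ) ∧
      (∀ i, (pauliThree * (U i * traceFirst ρ * (U i)ᴴ)).trace = 0) ∧
      ∀ p : ℝ, 1 ≤ p →
        pNorm p (idTensor Φ ρ) ≤
          (mFun p 0)⁻¹ * maxPNorm p Φ *
            ∑ i, c i * pNorm p (idTensor (phaseDamping 0)
              (((1 : Matrix (Fin K) (Fin K) ℂ) ⊗ₖ U i) * ρ *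
                ((1 : Matrix (Fin K) (Fin K) ℂ) ⊗ₖ (U i)ᴴ))) := by
  have hr := traceFirst_isHermitian hρ.1.1
  set R := traceFirst ρ with hR
  obtain ⟨t, ht, hν, N, c, A, V, a, hc, hc1, hA, hV, hVa, har, hΦeq⟩ :=
    hΦ.exists_phaseDamping_mixture hΦ_unital
      ![2 * (R 0 1).re, -(2 * (R 0 1).im), (R 0 0).re - (R 1 1).re]
  have hstar : ∀ B : Matrix (Fin 2) (Fin 2) ℂ, (1 : Matrix (Fin K) (Fin K) ℂ) ⊗ₖ Bᴴ =
      ((1 : Matrix (Fin K) (Fin K) ℂ) ⊗ₖ B)ᴴ := by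
    intro B
    rw [Matrix.conjTranspose_kronecker, Matrix.conjTranspose_one]
  refine ⟨N, c, fun i => (V i)ᴴ, ?_, hc, hc1, fun i => unitary_conjTranspose_mem (hV i),
    fun i => ?_, fun p hp => ?_⟩
  · rw [Nat.one_le_iff_ne_zero]
    rintro rfl
    simp at hc1
  · have h1 : (pauliThree * ((V i)ᴴ * R * (V i)ᴴᴴ)).trace =
        ((V i * pauliThree * (V i)ᴴ) * R).trace := by
      rw [Matrix.conjTranspose_conjTranspose, ← mul_assoc, Matrix.trace_mul_comm]
      simp only [mul_assoc]
    rw [h1, ← hVa, trace_pauliMat_mul _ hr, har, Complex.ofReal_zero]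
  -- Rotate, damp with `Ψ_t`, rotate back, and average.
  · let σ : Fin N → Matrix (Fin K × Fin 2) (Fin K × Fin 2) ℂ := fun i =>
      ((1 : Matrix (Fin K) (Fin K) ℂ) ⊗ₖ (V i)ᴴ) * ρ * ((1 : Matrix (Fin K) (Fin K) ℂ) ⊗ₖ (V i)ᴴᴴ)
    have hσ : ∀ i, (σ i).PosSemidef := by
      intro i
      have := hρ.1.mul_mul_conjTranspose_same ((1 : Matrix (Fin K) (Fin K) ℂ) ⊗ₖ (V i)ᴴ)
      rwa [← hstar] at this
    have hτ : ∀ i, (idTensor (phaseDamping t) (σ i)).PosSemidef := fun i =>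
      idTensor_phaseDamping_posSemidef ht (hσ i)
    have hsum : idTensor Φ ρ = ∑ i, (c i : ℂ) • (((1 : Matrix (Fin K) (Fin K) ℂ) ⊗ₖ A i) *
        idTensor (phaseDamping t) (σ i) * ((1 : Matrix (Fin K) (Fin K) ℂ) ⊗ₖ A i)ᴴ) := by
      ext x y
      have hblock : ∀ i, (Matrix.of fun a b => σ i (x.1, a) (y.1, b)) =
          (V i)ᴴ * (Matrix.of fun a b => ρ (x.1, a) (y.1, b)) * V i := by
        intro i
        ext a b
        simp only [σ, Matrix.of_apply]
        rw [one_kronecker_mul_mul_apply, Matrix.conjTranspose_conjTranspose]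
      rw [Matrix.sum_apply]
      simp only [← hstar, Matrix.smul_apply, one_kronecker_mul_mul_apply]
      change Φ (Matrix.of fun a b => ρ (x.1, a) (y.1, b)) x.2 y.2 = _
      rw [hΦeq, Matrix.sum_apply]
      refine Finset.sum_congr rfl fun i _ => ?_
      rw [Matrix.smul_apply, ← hblock]
      rfl
    have hm0 : 0 ≤ mFun p 0 := mFun_nonneg (by simp)
    calc pNorm p (idTensor Φ ρ)
        ≤ ∑ i, c i * pNorm p (((1 : Matrix (Fin K) (Fin K) ℂ) ⊗ₖ A i) *
            idTensor (phaseDamping t) (σ i) * ((1 : Matrix (Fin K) (Fin K) ℂ) ⊗ₖ A i)ᴴ) := by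
          rw [hsum]
          exact pNorm_sum_le _ _ _ (fun i => (hc i).le)
            (fun i => (hτ i).mul_mul_conjTranspose_same _) hp
      _ = ∑ i, c i * pNorm p (idTensor (phaseDamping t) (σ i)) :=
          Finset.sum_congr rfl fun i _ => by
            rw [pNorm_unitary_conj (hτ i) (one_kronecker_mem_unitaryGroup K (hA i))]
      _ ≤ ∑ i, (mFun p 0)⁻¹ * maxPNorm p Φ *
            (c i * pNorm p (idTensor (phaseDamping 0) (σ i))) := by
          refine Finset.sum_le_sum fun i _ => ?_
          have h1 := pNorm_idTensor_phaseDamping_le ht (hσ i) hp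
          have h0 := pNorm_nonneg (idTensor_phaseDamping_posSemidef (t := 0) (by simp) (hσ i)) p
          have h2 : (mFun p 0)⁻¹ * mFun p t * pNorm p (idTensor (phaseDamping 0) (σ i)) ≤
              (mFun p 0)⁻¹ * maxPNorm p Φ * pNorm p (idTensor (phaseDamping 0) (σ i)) :=
            mul_le_mul_of_nonneg_right
              (mul_le_mul_of_nonneg_left (hν p hp) (inv_nonneg.mpr hm0)) h0
          have h3 := mul_le_mul_of_nonneg_left (h1.trans h2) (hc i).le
          linarith
      _ = _ := by rw [← Finset.mul_sum]
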